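/- Let $G$ be a locally compact second countable group. Banach spaces are real; $L^p(\mu)$ denotes the space of classes of real $p$-integrable functions on a standard Borel space with a $\sigma$-finite measure $\mu$. A linear isometric representation of $G$ on a Banach space $B$ is a homomorphism $\varrho$ from $G$ to the group of invertible linear isometries of $B$ with continuous orbit maps. It almost has invariant vectors if for every compact $K\subseteq G$ one has $\inf_{\|v\|=1}\operatorname{diam}(\varrho(K)v)=0$ (the infimum of the empty set being $+\infty$). $G$ has property $(T_B)$ if for every linear isometric representation $\varrho$ of $G$ on $B$, with subspace $B^{\varrho(G)}$ of fixed vectors, the induced representation on the quotient $B/B^{\varrho(G)}$ does not almost have invariant vectors. $G$ has property $(F_B)$ if every continuous action of $G$ on $B$ by affine isometries has a fixed point. $G$ has Kazhdan's property $(T)$ if there are a compact $K\subseteq G$ and $\varepsilon>0$ such that for every strongly continuous unitary representation $\pi$ of $G$ on a complex Hilbert space $\mathcal H$ and every non-zero $v$ in the orthogonal complement of $\mathcal H^{\pi(G)}$ there is $g\in K$ with $\|\pi(g)v-v\|\ge\varepsilon\|v\|$. Then: (1) For every Banach space $B$, property $(F_B)$ implies property $(T_B)$. (2) If $G$ has property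 $(T)$, then $G$ has property $(F_B)$ for every closed linear subspace $B$ of every $L^p(\mu)$ with $1<p\le 2$. Moreover, if $G$ has property $(T)$, then for every linear subspace $B$ of $L^p(\mu)$ with $0<p\le 1$, every continuous action of $G$ on $B$ by affine isometries has bounded orbits; here, for $p<1$, continuity, isometry and boundedness refer to the pseudo-norm $\|f\|_p=(\int|f|^p\,d\mu)^{1/p}$ (equivalently to the metric $\|f-g\|_p^p$). (3) If $G$ has property $(T)$, then there is $\varepsilon=\varepsilon(G)>0$, depending only on $G$, such that $G$ has property $(F_B)$ for every closed linear subspace $B$ of every $L^p(\mu)$ with $2\le p<2+\varepsilon$. -/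

import Mathlib

open MeasureTheory Topology
open scoped ENNReal

universe u v w

section Representations

variable {𝕜 G V : Type*} [RCLike 𝕜] [Group G]

/-- A linear isometric representation of the topological group `G`: every `ρ g` preserves the
norm (it is invertible, with inverse `ρ g⁻¹`) and all orbit maps are continuous. On a complex
Hilbert space this is a (strongly continuous) unitary representation. -/
structure IsIsometricRep [TopologicalSpace G] [SeminormedAddCommGroup V] [Module 𝕜 V]
    (ρ : Representation 𝕜 G V) : Prop where
  norm_map : ∀ (g : G) (v : V), ‖ρ g v‖ = ‖v‖
  continuous_orbit : ∀ v : V, Continuous fun g : G => ρ g v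

theorem invariants_le_comap [AddCommGroup V] [Module 𝕜 V] (ρ : Representation 𝕜 G V) (g : G) :
    ρ.invariants ≤ ρ.invariants.comap (ρ g) := by
  intro v hv
  have h : ρ g v = v := hv g
  rw [Submodule.mem_comap, h]
  exact hv

/-- The representation induced by `ρ` on the quotient of `V` by its subspace of `G`-fixed
vectors. -/
noncomputable def quotientByInvariants [AddCommGroup V] [Module 𝕜 V] (ρ : Representation 𝕜 G V) :
    Representation 𝕜 G (V ⧸ ρ.invariants) :=
  ρ.quotient ρ.invariants (invariants_le_comap ρ)

/-- `ρ` almost has invariant vectors: for every compact `K ⊆ G`, the infimum of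
`diam (ρ(K) v)` over the unit vectors `v` is zero (the infimum over an empty unit sphere
being `+∞`). -/
def AlmostHasInvariantVectors [TopologicalSpace G] [SeminormedAddCommGroup V] [Module 𝕜 V]
    (ρ : Representation 𝕜 G V) : Prop :=
  ∀ K : Set G, IsCompact K → ∀ ε : ℝ, 0 < ε →
    ∃ v : V, ‖v‖ = 1 ∧ Metric.diam ((fun g : G => ρ g v) '' K) < ε

end Representations

/-- Kazhdan's property (T): there are a compact `K ⊆ G` and `ε > 0` such that, for every unitary
representation of `G` on a complex Hilbert space, the orthogonal complement of the space of
invariant vectors contains no `(K, ε)`-almost invariant vector. -/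
def HasPropertyT (G : Type u) [Group G] [TopologicalSpace G] : Prop :=
  ∃ K : Set G, IsCompact K ∧ ∃ ε : ℝ, 0 < ε ∧
    ∀ (H : Type v) [NormedAddCommGroup H] [InnerProductSpace ℂ H] [CompleteSpace H]
      (ρ : Representation ℂ G H), IsIsometricRep ρ →
      ∀ x ∈ (ρ.invariants)ᗮ, x ≠ 0 → ∃ g ∈ K, ε * ‖x‖ ≤ ‖ρ g x - x‖

/-- Property `(T_B)` of `G` for a real Banach space `B`: for no linear isometric representation on
`B` does the quotient representation on `B / B^G` almost have invariant vectors. -/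
def HasPropertyTB (G : Type u) [Group G] [TopologicalSpace G]
    (B : Type w) [NormedAddCommGroup B] [NormedSpace ℝ B] : Prop :=
  ∀ ρ : Representation ℝ G B, IsIsometricRep ρ →
    ¬ AlmostHasInvariantVectors (quotientByInvariants ρ)

/-- Property `(F_B)` of `G` for a real Banach space `B`: every continuous action of `G` on `B` by
affine isometries has a fixed point. -/
def HasPropertyFB (G : Type u) [Group G] [TopologicalSpace G]
    (B : Type w) [NormedAddCommGroup B] [NormedSpace ℝ B] : Prop :=
  ∀ α : G →* (B ≃ᵃⁱ[ℝ] B), (Continuous fun q : G × B => α q.1 q.2) →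
    ∃ x : B, ∀ g : G, α g x = x

section PseudoNormed

variable {X : Type v} [MeasurableSpace X] {μ : Measure X} {p : ℝ≥0∞}

/-- The distance `‖x - y‖_p = (∫ |x - y| ^ p) ^ (1 / p)` on a linear subspace of `L^p(μ)`.
For `p < 1` it is not a metric, but its `p`-th power is one. -/
noncomputable def lpDist (B : Submodule ℝ (Lp ℝ p μ)) (x y : B) : ℝ :=
  ‖(x : Lp ℝ p μ) - (y : Lp ℝ p μ)‖

/-- A continuous action by affine isometries of `G` on a linear subspace `B` of `L^p(μ)`, where
`p < 1` is allowed. The action is isometric for `‖x - y‖_p` (equivalently for the metric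
`‖x - y‖_p ^ p`), and the map `G × B → B` is jointly continuous, where `B` carries the topology
whose basic neighbourhoods of `x` are the sets `{y | ‖y - x‖_p < δ}`. -/
structure IsLpAffineIsometricAction {G : Type u} [Group G] [TopologicalSpace G]
    (B : Submodule ℝ (Lp ℝ p μ)) (α : G →* (B ≃ᵃ[ℝ] B)) : Prop where
  isometry : ∀ (g : G) (x y : B), lpDist B (α g x) (α g y) = lpDist B x y
  continuous : ∀ (g₀ : G) (x₀ : B) (ε : ℝ), 0 < ε →
    ∃ U ∈ 𝓝 g₀, ∃ δ : ℝ, 0 < δ ∧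
      ∀ g ∈ U, ∀ x : B, lpDist B x x₀ < δ → lpDist B (α g x) (α g₀ x₀) < ε

/-- Every orbit of every continuous action of `G` by affine isometries on the linear subspace `B`
of `L^p(μ)` is bounded. -/
def HasBoundedLpOrbits (G : Type u) [Group G] [TopologicalSpace G]
    (B : Submodule ℝ (Lp ℝ p μ)) : Prop :=
  ∀ α : G →* (B ≃ᵃ[ℝ] B), IsLpAffineIsometricAction B α →
    ∀ x : B, ∃ C : ℝ, ∀ g : G, lpDist B (α g x) 0 ≤ C

end PseudoNormed

/-! Part (1) is a closed graph argument. If the quotient representation almost has invariant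
vectors, there are `u n` whose classes modulo `B^G` have norm `n + 1` but which move by at most `1`
on the `n`-th set of a compact exhaustion. For `a` in ℓ¹ the series `∑ a n • (ρ g (u n) - u n)` is a
continuous cocycle, and `(F_B)` makes it a coboundary. Its primitive is unique modulo `B^G`, so ℓ¹
maps linearly to `B / B^G`. The graph is closed, hence the map is bounded, yet the `n`-th basis
vector goes to the class of `u n`.

Part (2) rests on the kernel `‖f - g‖_p ^ p`, which is conditionally of negative type for `0 < p ≤
2`. By Schoenberg, `exp (-t ψ)` is then a positive invariant kernel; its GNS representation is
unitary, and for small `t` a Kazhdan pair keeps the kernel away from `0` on an orbit, so `ψ` is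
bounded there (`HasPropertyT.condNegKernel_bounded`). For `1 < p ≤ 2` uniform convexity gives the
bounded orbit a unique Chebyshev centre, which is fixed.

For part (3) it suffices to halve the displacement on a compact generating set at a cost linear in
it: iterating then converges to a fixed point. If halving fails for every `ε`, there are
counterexamples with exponents tending to `2`. Averaging over the group makes their orbits
equicontinuous uniformly in the sequence. After rescaling, the ultralimit of the kernels `‖·‖ ^ r n`
is of negative type, so property (T) bounds its orbits. A near-centre of a limit orbit barely moves
by a Clarkson inequality, and its coordinates contradict the choice of the counterexamples. -/

/-! ### Positive kernels, kernels of negative type, and Schoenberg's theorem -/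

section Kernels

variable {S T : Type*}

/-- The quadratic form `∑ᵢⱼ cᵢ cⱼ k(i, j)` of a real kernel `k`. -/
noncomputable def kernelForm (k : S → S → ℝ) (c : S →₀ ℝ) : ℝ :=
  ∑ i ∈ c.support, ∑ j ∈ c.support, c i * c j * k i j

/-- The kernel `k` is symmetric and positive semidefinite. -/
structure IsPosKernel (k : S → S → ℝ) : Prop where
  symm : ∀ i j, k i j = k j i
  nonneg : ∀ c : S →₀ ℝ, 0 ≤ kernelForm k c

/-- The kernel `k` is symmetric, vanishes on the diagonal and is conditionally of negative type. -/
structure IsCondNegKernel (k : S → S → ℝ) : Prop where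
  symm : ∀ i j, k i j = k j i
  diag : ∀ i, k i i = 0
  nonpos : ∀ c : S →₀ ℝ, ∑ i ∈ c.support, c i = 0 → kernelForm k c ≤ 0

theorem kernelForm_eq_of_subset (k : S → S → ℝ) (c : S →₀ ℝ) {s : Finset S}
    (h : c.support ⊆ s) : kernelForm k c = ∑ i ∈ s, ∑ j ∈ s, c i * c j * k i j := by
  rw [kernelForm]
  rw [← Finset.sum_subset h]
  · refine Finset.sum_congr rfl fun i _ => Finset.sum_subset h fun j _ hj => ?_
    simp [Finsupp.notMem_support_iff.1 hj]
  · intro i _ hi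
    simp [Finsupp.notMem_support_iff.1 hi]

/-- The bridge to matrices, through which the Schur product theorem gives products of kernels. -/
theorem isPosKernel_iff (k : S → S → ℝ) : IsPosKernel k ↔ (Matrix.of k).PosSemidef := by
  constructor
  · intro h
    refine ⟨Matrix.IsHermitian.ext fun i j => by simp [h.symm i j], fun c => ?_⟩
    have := h.nonneg c
    simpa [kernelForm, Finsupp.sum, mul_right_comm] using this
  · intro h
    refine ⟨fun i j => by simpa using h.1.apply j i, fun c => ?_⟩
    have := h.2 c
    simpa [kernelForm, Finsupp.sum, mul_right_comm] using this

theorem IsPosKernel.mul {k l : S → S → ℝ} (hk : IsPosKernel k) (hl : IsPosKernel l) :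
    IsPosKernel fun i j => k i j * l i j := by
  rw [isPosKernel_iff] at *
  exact hk.hadamard hl

theorem isPosKernel_rankOne (f : S → ℝ) : IsPosKernel fun i j => f i * f j := by
  refine ⟨fun i j => mul_comm _ _, fun c => ?_⟩
  have : kernelForm (fun i j => f i * f j) c = (∑ i ∈ c.support, c i * f i) ^ 2 := by
    rw [kernelForm, sq, Finset.sum_mul_sum]
    refine Finset.sum_congr rfl fun i _ => Finset.sum_congr rfl fun j _ => by ring
  rw [this]; positivity

theorem IsPosKernel.add {k l : S → S → ℝ} (hk : IsPosKernel k) (hl : IsPosKernel l) :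
    IsPosKernel fun i j => k i j + l i j := by
  rw [isPosKernel_iff] at *
  exact Matrix.PosSemidef.add hk hl

theorem IsPosKernel.const_mul {k : S → S → ℝ} (hk : IsPosKernel k) {a : ℝ} (ha : 0 ≤ a) :
    IsPosKernel fun i j => a * k i j := by
  have := isPosKernel_rankOne (S := S) fun _ => Real.sqrt a
  simpa [Real.mul_self_sqrt ha] using this.mul hk

theorem IsPosKernel.pow {k : S → S → ℝ} (hk : IsPosKernel k) (n : ℕ) :
    IsPosKernel fun i j => k i j ^ n := by
  induction n with
  | zero => simpa using isPosKernel_rankOne (S := S) fun _ => 1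
  | succ n ih => simpa [pow_succ] using ih.mul hk

theorem tendsto_kernelForm {ι : Type*} {l : Filter ι} {k : ι → S → S → ℝ} {k' : S → S → ℝ}
    (h : ∀ i j, Filter.Tendsto (fun n => k n i j) l (𝓝 (k' i j))) (c : S →₀ ℝ) :
    Filter.Tendsto (fun n => kernelForm (k n) c) l (𝓝 (kernelForm k' c)) :=
  tendsto_finsetSum _ fun i _ => tendsto_finsetSum _ fun j _ => (h i j).const_mul _

theorem IsPosKernel.of_tendsto {ι : Type*} {l : Filter ι} [l.NeBot] {k : ι → S → S → ℝ}
    {k' : S → S → ℝ} (hk : ∀ n, IsPosKernel (k n))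
    (h : ∀ i j, Filter.Tendsto (fun n => k n i j) l (𝓝 (k' i j))) : IsPosKernel k' := by
  refine ⟨fun i j => ?_, fun c => ?_⟩
  · refine tendsto_nhds_unique (h i j) ((h j i).congr fun n => (hk n).symm j i)
  · exact ge_of_tendsto' (tendsto_kernelForm h c) fun n => (hk n).nonneg c

/-- Partial sums of the exponential series are positive, being sums of nonnegative multiples of
powers, and positivity survives pointwise limits. -/
theorem IsPosKernel.exp {k : S → S → ℝ} (hk : IsPosKernel k) :
    IsPosKernel fun i j => Real.exp (k i j) := by
  have h : ∀ n : ℕ, IsPosKernel fun i j => ∑ m ∈ Finset.range n, (m.factorial : ℝ)⁻¹ * k i j ^ m := by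
    intro n
    induction n with
    | zero => simpa using isPosKernel_rankOne (S := S) fun _ => 0
    | succ n ih =>
      simp only [Finset.sum_range_succ]
      exact ih.add ((hk.pow n).const_mul (by positivity))
  refine IsPosKernel.of_tendsto (l := Filter.atTop) h fun i j => ?_
  have := (NormedSpace.expSeries_div_hasSum_exp (k i j)).tendsto_sum_nat
  rw [← Real.exp_eq_exp_ℝ] at this
  simpa [div_eq_inv_mul] using this

theorem kernelForm_sub (k l : S → S → ℝ) (c : S →₀ ℝ) :
    kernelForm (fun i j => k i j - l i j) c = kernelForm k c - kernelForm l c := by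
  simp [kernelForm, mul_sub, Finset.sum_sub_distrib]

theorem kernelForm_const (a : ℝ) (c : S →₀ ℝ) :
    kernelForm (fun _ _ => a) c = a * (∑ i ∈ c.support, c i) ^ 2 := by
  rw [kernelForm, sq, Finset.sum_mul_sum, Finset.mul_sum]
  refine Finset.sum_congr rfl fun i _ => ?_
  rw [Finset.mul_sum]
  refine Finset.sum_congr rfl fun j _ => by ring

theorem IsPosKernel.isCondNegKernel_const_sub {k : S → S → ℝ} (hk : IsPosKernel k) (a : ℝ) (h : ∀ i, k i i = a) :
    IsCondNegKernel fun i j => a - k i j := by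
  refine ⟨fun i j => by rw [hk.symm], fun i => by simp [h], fun c hc => ?_⟩
  rw [kernelForm_sub (fun _ _ => a), kernelForm_const, hc]
  have := hk.nonneg c
  simp [this]

/-- Moving the total mass of `c` to `o` gives `c'` of mass zero. As `ψ o o = 0`, the form of the new
kernel at `c` is minus the form of `ψ` at `c'`. -/
theorem IsCondNegKernel.isPosKernel {ψ : S → S → ℝ} (h : IsCondNegKernel ψ) (o : S) :
    IsPosKernel fun i j => ψ i o + ψ j o - ψ i j := by
  classical
  refine ⟨fun i j => by rw [h.symm i j]; ring, fun c => ?_⟩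
  set a := ∑ i ∈ c.support, c i with ha
  set c' : S →₀ ℝ := c - Finsupp.single o a with hc'
  set s : Finset S := insert o c.support with hs
  have hsub : c'.support ⊆ s := by
    refine Finsupp.support_sub.trans ?_
    rw [hs, Finset.insert_eq, Finset.union_comm]
    exact Finset.union_subset_union Finsupp.support_single_subset subset_rfl
  have hsub' : c.support ⊆ s := Finset.subset_insert _ _
  have hos : o ∈ s := Finset.mem_insert_self _ _
  have happ : ∀ i, c' i = c i - if o = i then a else 0 := fun i => by
    simp [hc', Finsupp.single_apply]
  have has : ∑ i ∈ s, c i = a := by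
    rw [ha]; symm
    exact Finset.sum_subset hsub' fun i _ hi => Finsupp.notMem_support_iff.1 hi
  have h0 : ∑ i ∈ c'.support, c' i = 0 := by
    rw [Finset.sum_subset hsub fun i _ hi => Finsupp.notMem_support_iff.1 hi]
    simp [happ, Finset.sum_sub_distrib, has, hos]
  have h1 := h.nonpos c' h0
  rw [kernelForm_eq_of_subset _ _ hsub] at h1
  rw [kernelForm_eq_of_subset _ _ hsub']
  have e1 : ∑ i ∈ s, ∑ j ∈ s, c' i * c' j * ψ i j
      = ∑ i ∈ s, ∑ j ∈ s, c i * c j * ψ i j - 2 * a * ∑ i ∈ s, c i * ψ i o := by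
    have e5 : ∀ i ∈ s, ∑ j ∈ s, c' i * c' j * ψ i j = ∑ j ∈ s, c i * c j * ψ i j - a * (c i * ψ i o)
        - (if o = i then a * ∑ j ∈ s, c j * ψ j o else 0) := fun i _ => by
      have e6 : ∑ j ∈ s, c' i * c' j * ψ i j = ∑ j ∈ s, c' i * c j * ψ i j - c' i * a * ψ i o := by
        simp only [happ _, mul_sub, sub_mul, Finset.sum_sub_distrib, mul_ite, ite_mul, mul_zero,
          zero_mul, Finset.sum_ite_eq, hos, if_true]
      rw [e6, happ i]
      split_ifs with hi
      · subst hi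
        simp only [sub_mul, Finset.sum_sub_distrib, h.diag, mul_assoc a, ← Finset.mul_sum]
        simp only [h.symm o]
        ring
      · simp only [sub_zero]; ring
    rw [Finset.sum_congr rfl e5]
    simp only [Finset.sum_sub_distrib, ← Finset.mul_sum, Finset.sum_ite_eq, hos, if_true]
    ring
  have e2 : ∑ i ∈ s, ∑ j ∈ s, c i * c j * (ψ i o + ψ j o - ψ i j)
      = 2 * a * ∑ i ∈ s, c i * ψ i o - ∑ i ∈ s, ∑ j ∈ s, c i * c j * ψ i j := by
    have e3 : ∑ i ∈ s, ∑ j ∈ s, c i * c j * ψ i o = a * ∑ i ∈ s, c i * ψ i o := by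
      rw [← has, mul_comm, Finset.sum_mul_sum]
      exact Finset.sum_congr rfl fun i _ => Finset.sum_congr rfl fun j _ => by ring
    have e4 : ∑ i ∈ s, ∑ j ∈ s, c i * c j * ψ j o = a * ∑ i ∈ s, c i * ψ i o := by
      rw [← has, Finset.sum_mul_sum]
      exact Finset.sum_congr rfl fun i _ => Finset.sum_congr rfl fun j _ => by ring
    simp only [mul_sub, mul_add, Finset.sum_sub_distrib, Finset.sum_add_distrib]
    rw [e3, e4]; ring
  rw [e2]; rw [e1] at h1; linarith

/-- Schoenberg: `exp (-t ψ)` is a rank one kernel times the exponential of `t` times the positive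
kernel based at `o`. -/
theorem IsCondNegKernel.exp_neg {ψ : S → S → ℝ} (h : IsCondNegKernel ψ) {t : ℝ} (ht : 0 ≤ t) :
    IsPosKernel fun i j => Real.exp (-(t * ψ i j)) := by
  rcases isEmpty_or_nonempty S with hS | ⟨⟨o⟩⟩
  · exact ⟨fun i => isEmptyElim i, fun c => by
      rw [Subsingleton.elim c 0]; simp [kernelForm]⟩
  have := (isPosKernel_rankOne fun i => Real.exp (-(t * ψ i o))).mul
    (((h.isPosKernel o).const_mul ht).exp)
  convert this using 3 with i j
  rw [← Real.exp_add, ← Real.exp_add]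
  congr 1; ring

/-- `ψ` behaves like a squared Hilbert distance. The positive kernel based at `b` is tested on the
sum of the point masses at `a` and `c`. -/
theorem IsCondNegKernel.quasi_triangle {ψ : S → S → ℝ} (h : IsCondNegKernel ψ) (a b c : S) :
    ψ a c ≤ 2 * ψ a b + 2 * ψ b c := by
  classical
  have hp := (h.isPosKernel b).nonneg (Finsupp.single a 1 + Finsupp.single c 1)
  rw [kernelForm_eq_of_subset _ _ (s := {a, c})] at hp
  · by_cases hac : a = c
    · subst hac
      simp [h.diag] at hp
      rw [h.symm b a, h.diag]
      linarith
    · simp [Finset.sum_pair hac, h.diag, Finsupp.single_apply, hac, Ne.symm hac] at hp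
      rw [h.symm c a] at hp
      rw [h.symm b c]
      linarith
  · refine Finsupp.support_add.trans ?_
    rw [Finset.insert_eq]
    exact Finset.union_subset_union Finsupp.support_single_subset Finsupp.support_single_subset

theorem IsCondNegKernel.nonneg {ψ : S → S → ℝ} (h : IsCondNegKernel ψ) (a b : S) : 0 ≤ ψ a b := by
  have := h.quasi_triangle a b a
  rw [h.diag, h.symm b a] at this
  linarith

/-- Since `f` may identify points, the coefficients are pushed forward along `f`; this keeps their
sum zero. -/
theorem IsCondNegKernel.comap {ψ : S → S → ℝ} (h : IsCondNegKernel ψ) (f : T → S) :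
    IsCondNegKernel fun i j => ψ (f i) (f j) := by
  classical
  refine ⟨fun i j => h.symm _ _, fun i => h.diag _, fun c hc => ?_⟩
  have h1 : ∀ F : S → ℝ → ℝ, (∀ s, F s 0 = 0) → (∀ s a b, F s (a + b) = F s a + F s b) →
      (c.mapDomain f).sum F = c.sum fun i a => F (f i) a := fun F h0 ha =>
    Finsupp.sum_mapDomain_index h0 ha
  have h2 := h.nonpos (c.mapDomain f) (by
    have := h1 (fun _ a => a) (fun _ => rfl) (fun _ _ _ => rfl)
    simpa [Finsupp.sum, hc] using this)
  have h3 : kernelForm ψ (c.mapDomain f) = kernelForm (fun i j => ψ (f i) (f j)) c := by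
    change ((c.mapDomain f).sum fun i a => (c.mapDomain f).sum fun j b => a * b * ψ i j) = _
    rw [h1]
    · refine Finset.sum_congr rfl fun i _ => ?_
      change ((c.mapDomain f).sum fun j b => c i * b * ψ (f i) j) = _
      rw [h1]
      · rfl
      · simp
      · intros; ring
    · simp
    · intro s a b
      simp [Finsupp.sum, add_mul, Finset.sum_add_distrib]
  rwa [h3] at h2

theorem isCondNegKernel_sq_sub (f : S → ℝ) : IsCondNegKernel fun i j => (f i - f j) ^ 2 := by
  refine ⟨fun i j => by ring, fun i => by simp, fun c hc => ?_⟩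
  have : kernelForm (fun i j => (f i - f j) ^ 2) c = 2 * (∑ i ∈ c.support, c i) *
      (∑ i ∈ c.support, c i * f i ^ 2) - 2 * (∑ i ∈ c.support, c i * f i) ^ 2 := by
    have e1 : ∀ i ∈ c.support, ∀ j ∈ c.support, c i * c j * (f i - f j) ^ 2
      = c i * (c j * f j ^ 2) + (c i * f i ^ 2) * c j - 2 * ((c i * f i) * (c j * f j)) := by
      intros; ring
    rw [kernelForm, Finset.sum_congr rfl fun i hi => Finset.sum_congr rfl (e1 i hi)]
    simp only [Finset.sum_sub_distrib, Finset.sum_add_distrib, ← Finset.mul_sum, ← Finset.sum_mul]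
    ring
  rw [this, hc]
  have := sq_nonneg (∑ i ∈ c.support, c i * f i)
  simp only [mul_zero, zero_mul]; linarith

/-- A Laplace transform: `(t + ψ)⁻¹` is the integral over `x > 0` of `exp (-t x)` times the
Schoenberg kernel `exp (-x ψ)`. -/
theorem IsCondNegKernel.isPosKernel_inv {ψ : S → S → ℝ} (h : IsCondNegKernel ψ) {t : ℝ}
    (ht : 0 < t) : IsPosKernel fun i j => (t + ψ i j)⁻¹ := by
  refine ⟨fun i j => by rw [h.symm], fun c => ?_⟩
  have hpos : ∀ i j, 0 < t + ψ i j := fun i j => by linarith [h.nonneg i j]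
  have e : ∀ i j, (t + ψ i j)⁻¹ = ∫ x in Set.Ioi (0 : ℝ), Real.exp (-(t + ψ i j) * x) := by
    intro i j
    rw [integral_exp_mul_Ioi (by linarith [hpos i j])]
    rw [mul_zero, Real.exp_zero, neg_div_neg_eq, one_div]
  have hint : ∀ i j, IntegrableOn (fun x : ℝ => Real.exp (-(t + ψ i j) * x)) (Set.Ioi 0) :=
    fun i j => integrableOn_exp_mul_Ioi (by linarith [hpos i j]) 0
  have : kernelForm (fun i j => (t + ψ i j)⁻¹) c = ∫ x in Set.Ioi (0 : ℝ),
      kernelForm (fun i j => Real.exp (-(t + ψ i j) * x)) c := by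
    simp only [kernelForm]
    rw [integral_finsetSum _ fun i _ => integrable_finsetSum _ fun j _ => (hint i j).const_mul _]
    refine Finset.sum_congr rfl fun i _ => ?_
    rw [integral_finsetSum _ fun j _ => (hint i j).const_mul _]
    refine Finset.sum_congr rfl fun j _ => ?_
    rw [integral_const_mul, e]
  rw [this]
  refine setIntegral_nonneg measurableSet_Ioi fun x hx => ?_
  have := ((h.exp_neg (le_of_lt hx)).const_mul (Real.exp_nonneg (-(t * x)))).nonneg c
  convert this using 4 with i j
  rw [← Real.exp_add]; ring_nf

/-- For `α < 1`, `ψ ^ α` is a positive multiple of the integral over `t > 0` of `t ^ α * (t⁻¹ - (t +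
ψ)⁻¹)`, and each integrand is a constant minus a positive kernel with that constant on the diagonal.
-/
theorem IsCondNegKernel.rpow {ψ : S → S → ℝ} (h : IsCondNegKernel ψ) {α : ℝ}
    (h0 : 0 < α) (h1 : α ≤ 1) : IsCondNegKernel fun i j => ψ i j ^ α := by
  rcases h1.eq_or_lt with rfl | h1
  · simpa using h
  have hα : α ∈ Set.Ioo (0 : ℝ) 1 := ⟨h0, h1⟩
  refine ⟨fun i j => by rw [h.symm], fun i => by simp [h.diag, Real.zero_rpow h0.ne'],
    fun c hc => ?_⟩
  have hint := fun i j => Real.integrableOn_rpowIntegrand₀₁_Ioi hα (h.nonneg i j)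
  have : kernelForm (fun i j => ψ i j ^ α) c =
      (∫ t in Set.Ioi 0, Real.rpowIntegrand₀₁ α t 1)⁻¹ * ∫ t in Set.Ioi (0 : ℝ),
      kernelForm (fun i j => Real.rpowIntegrand₀₁ α t (ψ i j)) c := by
    simp only [kernelForm]
    rw [integral_finsetSum _ fun i _ => integrable_finsetSum _ fun j _ => (hint i j).const_mul _,
      Finset.mul_sum]
    refine Finset.sum_congr rfl fun i _ => ?_
    rw [integral_finsetSum _ fun j _ => (hint i j).const_mul _, Finset.mul_sum]
    refine Finset.sum_congr rfl fun j _ => ?_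
    rw [integral_const_mul, Real.rpow_eq_const_mul_integral hα (h.nonneg i j)]
    ring
  rw [this]
  refine mul_nonpos_of_nonneg_of_nonpos
    (inv_nonneg.2 (Real.integral_rpowIntegrand₀₁_one_pos hα).le) ?_
  refine setIntegral_nonpos measurableSet_Ioi fun t ht => ?_
  have h2 := ((h.isPosKernel_inv ht).const_mul (Real.rpow_nonneg (le_of_lt ht) α)).isCondNegKernel_const_sub
    (t ^ α * t⁻¹) fun i => by simp [h.diag]
  have := h2.nonpos c hc
  convert this using 4 with i j
  rw [Real.rpowIntegrand₀₁]; ring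

/-- The kernel `|s - t| ^ p`, `0 < p ≤ 2`, is conditionally of negative type. -/
theorem isCondNegKernel_abs_sub_rpow (f : S → ℝ) {p : ℝ} (h0 : 0 < p) (h2 : p ≤ 2) :
    IsCondNegKernel fun i j => |f i - f j| ^ p := by
  have := (isCondNegKernel_sq_sub f).rpow (α := p / 2) (by linarith) (by linarith)
  convert this using 3 with i j
  rw [← sq_abs, ← Real.rpow_natCast, ← Real.rpow_mul (abs_nonneg _)]
  congr 1; push_cast; ring

end Kernels

/-! ### Continuity of isometric representations -/

section IsometricRep

variable {𝕜 G V : Type*} [RCLike 𝕜] [Group G] [TopologicalSpace G] [IsTopologicalGroup G]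
  [SeminormedAddCommGroup V] [Module 𝕜 V]

theorem IsIsometricRep.of_tendsto_one {ρ : Representation 𝕜 G V}
    (hn : ∀ (g : G) (v : V), ‖ρ g v‖ = ‖v‖)
    (hc : ∀ v : V, Filter.Tendsto (fun g => ‖ρ g v - v‖) (𝓝 1) (𝓝 0)) : IsIsometricRep ρ := by
  refine ⟨hn, fun v => continuous_iff_continuousAt.2 fun g₀ => ?_⟩
  rw [ContinuousAt, tendsto_iff_norm_sub_tendsto_zero]
  have h1 : Filter.Tendsto (fun g => g₀⁻¹ * g) (𝓝 g₀) (𝓝 1) := by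
    have : Continuous fun g : G => g₀⁻¹ * g := by fun_prop
    simpa using this.tendsto g₀
  refine ((hc v).comp h1).congr fun g => ?_
  rw [Function.comp_apply, ← hn g₀, map_sub, ← Module.End.mul_apply, ← map_mul, mul_inv_cancel_left]

end IsometricRep

/-! ### The unitary representation attached to an invariant positive kernel -/

section GNS

variable {S : Type v}

/-- The sesquilinear form on finitely supported functions given by a real kernel. -/
noncomputable def kernelInner (φ : S → S → ℝ) (f g : S →₀ ℂ) : ℂ :=
  f.sum fun s z => g.sum fun t w => star z * w * (φ s t : ℂ)

theorem kernelInner_single (φ : S → S → ℝ) (s t : S) :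
    kernelInner φ (Finsupp.single s 1) (Finsupp.single t 1) = φ s t := by
  rw [kernelInner, Finsupp.sum_single_index, Finsupp.sum_single_index]
  all_goals simp

theorem kernelInner_mapDomain {φ : S → S → ℝ} {f : S → S} (hf : ∀ s t, φ (f s) (f t) = φ s t)
    (x y : S →₀ ℂ) : kernelInner φ (x.mapDomain f) (y.mapDomain f) = kernelInner φ x y := by
  rw [kernelInner, Finsupp.sum_mapDomain_index]
  · refine Finset.sum_congr rfl fun i _ => ?_
    change ((y.mapDomain f).sum fun t w => star (x i) * w * (φ (f i) t : ℂ)) = _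
    rw [Finsupp.sum_mapDomain_index]
    · simp only [hf]
    · simp
    · intros; ring
  · simp
  · intros
    simp only [star_add, add_mul, Finsupp.sum_add]

theorem kernelInner_conj {φ : S → S → ℝ} (hφ : IsPosKernel φ) (f g : S →₀ ℂ) :
    (starRingEnd ℂ) (kernelInner φ g f) = kernelInner φ f g := by
  rw [kernelInner, Finsupp.sum_comm]
  simp only [map_finsuppSum]
  refine Finset.sum_congr rfl fun i _ => Finset.sum_congr rfl fun j _ => ?_
  simp [hφ.symm i j, mul_comm]

theorem kernelInner_add_left (φ : S → S → ℝ) (f g h : S →₀ ℂ) :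
    kernelInner φ (f + g) h = kernelInner φ f h + kernelInner φ g h := by
  rw [kernelInner, Finsupp.sum_add_index'] <;> simp [kernelInner, ← Finsupp.sum_add, add_mul]

theorem kernelInner_smul_left (φ : S → S → ℝ) (f g : S →₀ ℂ) (z : ℂ) :
    kernelInner φ (z • f) g = (starRingEnd ℂ) z * kernelInner φ f g := by
  rw [kernelInner, Finsupp.sum_smul_index] <;>
    simp [kernelInner, Finsupp.mul_sum, ← mul_assoc]

/-- As `φ` is real, the real part splits into the real forms at the real and imaginary parts of `f`.
-/
theorem kernelInner_self_nonneg {φ : S → S → ℝ} (hφ : IsPosKernel φ) (f : S →₀ ℂ) :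
    0 ≤ (kernelInner φ f f).re := by
  have h1 : ∀ {F : ℂ → ℝ} (hF : F 0 = 0), kernelForm φ (Finsupp.mapRange F hF f) =
      ∑ i ∈ f.support, ∑ j ∈ f.support, F (f i) * F (f j) * φ i j := fun hF => by
    rw [kernelForm_eq_of_subset _ _ Finsupp.support_mapRange]
    simp
  have h2 := hφ.nonneg (Finsupp.mapRange Complex.re Complex.zero_re f)
  have h3 := hφ.nonneg (Finsupp.mapRange Complex.im Complex.zero_im f)
  rw [h1] at h2 h3
  have h4 := add_nonneg h2 h3
  simp only [← Finset.sum_add_distrib] at h4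
  refine h4.trans_eq ?_
  rw [kernelInner, Finsupp.sum, Complex.re_sum]
  simp only [Finsupp.sum, Complex.re_sum]
  refine Finset.sum_congr rfl fun i _ => Finset.sum_congr rfl fun j _ => ?_
  simp
  ring

/-- Finitely supported functions on `S`, with the semi-inner product of a positive kernel. -/
def KernelPreHilbert {φ : S → S → ℝ} (_ : IsPosKernel φ) : Type v := S →₀ ℂ

variable {φ : S → S → ℝ} (hφ : IsPosKernel φ)

noncomputable instance : AddCommGroup (KernelPreHilbert hφ) := inferInstanceAs (AddCommGroup (S →₀ ℂ))

noncomputable instance : Module ℂ (KernelPreHilbert hφ) := inferInstanceAs (Module ℂ (S →₀ ℂ))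

noncomputable instance : PreInnerProductSpace.Core ℂ (KernelPreHilbert hφ) where
  inner f g := kernelInner φ f g
  conj_inner_symm f g := kernelInner_conj hφ f g
  add_left f g h := kernelInner_add_left φ f g h
  smul_left f g z := kernelInner_smul_left φ f g z
  re_inner_nonneg f := kernelInner_self_nonneg hφ f

noncomputable instance : SeminormedAddCommGroup (KernelPreHilbert hφ) :=
  InnerProductSpace.Core.toSeminormedAddCommGroup (𝕜 := ℂ)

noncomputable instance : InnerProductSpace ℂ (KernelPreHilbert hφ) := .ofCore _

/-- The vector attached to a point of `S`. -/
noncomputable def KernelPreHilbert.point (s : S) : KernelPreHilbert hφ := Finsupp.single s (1 : ℂ)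

theorem KernelPreHilbert.norm_sq (f : KernelPreHilbert hφ) : ‖f‖ ^ 2 = (inner ℂ f f : ℂ).re :=
  InnerProductSpace.norm_sq_eq_re_inner (𝕜 := ℂ) f

theorem KernelPreHilbert.inner_point (s t : S) : inner ℂ (point hφ s) (point hφ t) = (φ s t : ℂ) :=
  kernelInner_single φ s t

theorem KernelPreHilbert.norm_point_sub_sq (s t : S) :
    ‖point hφ s - point hφ t‖ ^ 2 = φ s s - 2 * φ s t + φ t t := by
  rw [norm_sq, inner_sub_left, inner_sub_right, inner_sub_right]
  simp only [inner_point, hφ.symm t s]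
  simp
  ring

theorem KernelPreHilbert.induction {p : KernelPreHilbert hφ → Prop} (f : KernelPreHilbert hφ)
    (h0 : p 0) (hadd : ∀ f g, p f → p g → p (f + g)) (hs : ∀ (s : S) (z : ℂ), p (z • point hφ s)) :
    p f := by
  refine Finsupp.induction_linear f h0 hadd fun s z => ?_
  have := hs s z
  have e : z • point hφ s = Finsupp.single s z := by
    change z • (Finsupp.single s (1 : ℂ)) = _
    simp
  rwa [e] at this

/-- The isometry of the pre-Hilbert space induced by a map preserving the kernel. -/
noncomputable def KernelPreHilbert.map (f : S → S) (hf : ∀ s t, φ (f s) (f t) = φ s t) :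
    KernelPreHilbert hφ →ₗᵢ[ℂ] KernelPreHilbert hφ where
  toLinearMap := Finsupp.lmapDomain ℂ ℂ f
  norm_map' x := by
    refine (sq_eq_sq₀ (norm_nonneg _) (norm_nonneg _)).1 ?_
    rw [norm_sq, norm_sq]
    exact congrArg Complex.re (kernelInner_mapDomain hf x x)

theorem KernelPreHilbert.map_point (f : S → S) (hf : ∀ s t, φ (f s) (f t) = φ s t) (s : S) :
    map hφ f hf (point hφ s) = point hφ (f s) :=
  Finsupp.mapDomain_single

open UniformSpace in
/-- The unitary representation on the Hilbert space of an invariant positive kernel. -/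
noncomputable def kernelRep {G : Type u} [Group G] (a : G →* Equiv.Perm S)
    (ha : ∀ g s t, φ (a g s) (a g t) = φ s t) :
    Representation ℂ G (Completion (KernelPreHilbert hφ)) where
  toFun g := ((KernelPreHilbert.map hφ (a g) (ha g)).toContinuousLinearMap.completion :
    Completion (KernelPreHilbert hφ) →ₗ[ℂ] Completion (KernelPreHilbert hφ))
  map_one' := by
    refine LinearMap.ext fun x => ?_
    induction x using Completion.induction_on with
    | hp => exact isClosed_eq (ContinuousLinearMap.continuous
        (KernelPreHilbert.map hφ (a 1) (ha 1)).toContinuousLinearMap.completion) continuous_id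
    | ih x =>
      refine (ContinuousLinearMap.completion_apply_coe _ _).trans ?_
      refine congrArg _ ?_
      change Finsupp.mapDomain (a 1) x = x
      rw [map_one]
      exact Finsupp.mapDomain_id
  map_mul' g h := by
    refine LinearMap.ext fun x => ?_
    induction x using Completion.induction_on with
    | hp =>
      exact isClosed_eq (ContinuousLinearMap.continuous
          (KernelPreHilbert.map hφ (a (g * h)) (ha (g * h))).toContinuousLinearMap.completion)
        ((ContinuousLinearMap.continuous
          (KernelPreHilbert.map hφ (a g) (ha g)).toContinuousLinearMap.completion).comp
        (ContinuousLinearMap.continuous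
          (KernelPreHilbert.map hφ (a h) (ha h)).toContinuousLinearMap.completion))
    | ih x =>
      refine (ContinuousLinearMap.completion_apply_coe _ _).trans
        (Eq.trans ?_ (congrArg (ContinuousLinearMap.completion _)
          (ContinuousLinearMap.completion_apply_coe _ _)).symm)
      refine Eq.trans ?_ (ContinuousLinearMap.completion_apply_coe _ _).symm
      refine congrArg _ ?_
      change Finsupp.mapDomain (a (g * h)) x = Finsupp.mapDomain (a g) (Finsupp.mapDomain (a h) x)
      rw [map_mul]
      exact Finsupp.mapDomain_comp (M := ℂ) (f := a h) (g := a g)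

open UniformSpace in
theorem kernelRep_coe {G : Type u} [Group G] (a : G →* Equiv.Perm S)
    (ha : ∀ g s t, φ (a g s) (a g t) = φ s t) (g : G) (x : KernelPreHilbert hφ) :
    kernelRep hφ a ha g (x : Completion (KernelPreHilbert hφ)) =
      ((KernelPreHilbert.map hφ (a g) (ha g) x : KernelPreHilbert hφ) :
        Completion (KernelPreHilbert hφ)) :=
  ContinuousLinearMap.completion_apply_coe _ _

open UniformSpace in
-- The point `s` has squared displacement `2 (φ s s - φ (a g s) s)`, so `hc` gives continuity at `1`
-- on points, then on linear combinations, then on the completion by density, all operators being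
-- isometries.
theorem kernelRep_isIsometricRep {G : Type u} [Group G] [TopologicalSpace G] [IsTopologicalGroup G]
    (a : G →* Equiv.Perm S) (ha : ∀ g s t, φ (a g s) (a g t) = φ s t)
    (hc : ∀ s, Filter.Tendsto (fun g => φ (a g s) s) (𝓝 1) (𝓝 (φ s s))) :
    IsIsometricRep (kernelRep hφ a ha) := by
  have hn : ∀ g v, ‖kernelRep hφ a ha g v‖ = ‖v‖ := by
    intro g v
    induction v using Completion.induction_on with
    | hp => exact isClosed_eq (ContinuousLinearMap.continuous _).norm continuous_norm
    | ih x => rw [kernelRep_coe, Completion.norm_coe, Completion.norm_coe, LinearIsometry.norm_map]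
  refine IsIsometricRep.of_tendsto_one hn fun v => ?_
  have hpre : ∀ x : KernelPreHilbert hφ, Filter.Tendsto
      (fun g => ‖kernelRep hφ a ha g (x : Completion (KernelPreHilbert hφ)) - x‖) (𝓝 1) (𝓝 0) := by
    intro x
    induction x using KernelPreHilbert.induction with
    | h0 => simp [Completion.coe_zero]
    | hadd f g hf hg =>
      refine squeeze_zero (fun _ => norm_nonneg _) (fun k => ?_) (by simpa using hf.add hg)
      rw [Completion.coe_add, map_add, add_sub_add_comm]
      exact norm_add_le _ _
    | hs s z =>
      have h1 : Filter.Tendsto (fun g => Real.sqrt (2 * φ s s - 2 * φ (a g s) s)) (𝓝 1) (𝓝 0) := by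
        have := (((hc s).const_mul 2).const_sub (2 * φ s s)).sqrt
        simpa using this
      have h2 := h1.const_mul ‖z‖
      rw [mul_zero] at h2
      refine h2.congr fun g => ?_
      rw [Completion.coe_smul, map_smul, ← smul_sub, norm_smul]
      congr 1
      rw [kernelRep_coe, KernelPreHilbert.map_point, ← Completion.coe_sub, Completion.norm_coe,
        eq_comm, ← Real.sqrt_sq (norm_nonneg _), KernelPreHilbert.norm_point_sub_sq, ha]
      congr 1; ring
  rw [Metric.tendsto_nhds]
  intro ε hε
  obtain ⟨x, hx⟩ := Completion.denseRange_coe.exists_dist_lt v (show 0 < ε / 3 by positivity)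
  filter_upwards [Metric.tendsto_nhds.1 (hpre x) (ε / 3) (by positivity)] with g hg
  rw [Real.dist_0_eq_abs, abs_norm] at hg ⊢
  have : kernelRep hφ a ha g v - v = kernelRep hφ a ha g (v - x) +
      (kernelRep hφ a ha g x - x) - (v - x) := by rw [map_sub]; abel
  rw [this]
  rw [dist_eq_norm] at hx
  calc _ ≤ ‖kernelRep hφ a ha g (v - x)‖ + ‖kernelRep hφ a ha g x - x‖ + ‖v - x‖ :=
        (norm_sub_le _ _).trans (by gcongr; exact norm_add_le _ _)
    _ < ε := by rw [hn]; linarith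

end GNS

/-! ### Kazhdan pairs and kernels -/

section PropertyT

/-- If a Kazhdan pair `(K, ε)` is given, a vector moved by at most `δ` by `K` is moved by at most
`2 δ / ε` by the whole group. -/
theorem norm_sub_le_of_kazhdan {G H : Type*} [Group G] [TopologicalSpace G]
    [NormedAddCommGroup H] [InnerProductSpace ℂ H] [CompleteSpace H] {K : Set G} {ε : ℝ}
    (hε : 0 < ε) {ρ : Representation ℂ G H} (hρ : IsIsometricRep ρ)
    (hK : ∀ x ∈ (ρ.invariants)ᗮ, x ≠ 0 → ∃ g ∈ K, ε * ‖x‖ ≤ ‖ρ g x - x‖) {v : H} {δ : ℝ}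
    (h0 : 0 ≤ δ) (hv : ∀ g ∈ K, ‖ρ g v - v‖ ≤ δ) (g : G) : ‖ρ g v - v‖ ≤ 2 * δ / ε := by
  have hcl : IsClosed (ρ.invariants : Set H) := by
    have : (ρ.invariants : Set H) = ⋂ g : G, {v | ρ g v = v} := by
      ext v; simp
    rw [this]
    refine isClosed_iInter fun g => isClosed_eq ?_ continuous_id
    exact (LinearIsometry.mk (ρ g) (hρ.norm_map g)).continuous
  have : CompleteSpace ρ.invariants := hcl.completeSpace_coe
  -- Only the component `z` orthogonal to the invariants moves, and the Kazhdan pair bounds it by `δ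
  -- / ε`.
  obtain ⟨y, hy, z, hz, rfl⟩ := ρ.invariants.exists_add_mem_mem_orthogonal v
  have key : ∀ g, ρ g (y + z) - (y + z) = ρ g z - z := fun g => by
    rw [map_add, (ρ.mem_invariants y).1 hy g]; abel
  simp only [key] at hv ⊢
  have hz' : ‖z‖ ≤ δ / ε := by
    by_cases hz0 : z = 0
    · rw [hz0, norm_zero]; positivity
    · obtain ⟨k, hk, h⟩ := hK z hz hz0
      rw [le_div_iff₀ hε, mul_comm]
      exact h.trans (hv k hk)
  calc _ ≤ ‖ρ g z‖ + ‖z‖ := norm_sub_le _ _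
    _ ≤ δ / ε + δ / ε := by rw [hρ.norm_map]; linarith
    _ = _ := by ring

/-- A Kazhdan pair controls the variation of invariant positive kernels along orbits. -/
theorem HasPropertyT.posKernel_bound {G : Type u} [Group G] [TopologicalSpace G]
    [IsTopologicalGroup G] (hT : HasPropertyT.{u, v} G) :
    ∃ K : Set G, IsCompact K ∧ ∃ C : ℝ, 0 < C ∧ ∀ (S : Type v) (a : G →* Equiv.Perm S)
      (φ : S → S → ℝ), IsPosKernel φ → (∀ g s t, φ (a g s) (a g t) = φ s t) →
      (∀ s, Filter.Tendsto (fun g => φ (a g s) s) (𝓝 1) (𝓝 (φ s s))) →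
      ∀ (s : S) (m : ℝ), 0 ≤ m → (∀ g ∈ K, φ s s - φ (a g s) s ≤ m) →
        ∀ g, φ s s - φ (a g s) s ≤ C * m := by
  obtain ⟨K, hKc, ε, hε, hK⟩ := hT
  -- Squaring `2 δ / ε` with `δ ^ 2 = 2 m` gives `8 m / ε ^ 2`, a bound for twice the variation of
  -- `φ`.
  refine ⟨K, hKc, 4 / ε ^ 2, by positivity, fun S a φ hφ ha hc s m hm hs g => ?_⟩
  have hρ := kernelRep_isIsometricRep hφ a ha hc
  have hn : ∀ g, ‖kernelRep hφ a ha g (KernelPreHilbert.point hφ s) -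
      KernelPreHilbert.point hφ s‖ ^ 2 = 2 * (φ s s - φ (a g s) s) := fun g => by
    rw [kernelRep_coe, KernelPreHilbert.map_point, ← UniformSpace.Completion.coe_sub,
      UniformSpace.Completion.norm_coe, KernelPreHilbert.norm_point_sub_sq, ha]
    ring
  have h1 := norm_sub_le_of_kazhdan hε hρ (hK _ _ hρ) (δ := Real.sqrt (2 * m)) (Real.sqrt_nonneg _)
    (fun g hg => Real.le_sqrt_of_sq_le (by rw [hn]; linarith [hs g hg])) g
  have h2 := pow_le_pow_left₀ (norm_nonneg _) h1 2
  rw [hn, div_pow, mul_pow, Real.sq_sqrt (by positivity)] at h2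
  have : 4 / ε ^ 2 * m = 2 ^ 2 * (2 * m) / ε ^ 2 / 2 := by ring
  rw [this]; linarith

/-- Under property (T), an invariant continuous kernel conditionally of negative type is bounded
on orbits. -/
theorem HasPropertyT.condNegKernel_bounded {G : Type u} [Group G] [TopologicalSpace G]
    [IsTopologicalGroup G] (hT : HasPropertyT.{u, v} G) {S : Type v} (a : G →* Equiv.Perm S)
    {ψ : S → S → ℝ} (hψ : IsCondNegKernel ψ) (ha : ∀ g s t, ψ (a g s) (a g t) = ψ s t)
    (hc : ∀ s, Filter.Tendsto (fun g => ψ (a g s) s) (𝓝 1) (𝓝 0)) (s : S) :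
    ∃ C : ℝ, ∀ g, ψ (a g s) s ≤ C := by
  obtain ⟨K, hKc, C, hC, hK⟩ := hT.posKernel_bound
  -- Continuity is assumed only at `1`. Near `g₀` it is transported by invariance, and the
  -- quasi-triangle inequality turns it into a local bound.
  obtain ⟨M, hM⟩ : ∃ M : ℝ, ∀ g ∈ K, ψ (a g s) s ≤ M := by
    refine hKc.induction_on (p := fun K => ∃ M : ℝ, ∀ g ∈ K, ψ (a g s) s ≤ M) ⟨0, by simp⟩
      (fun s t hst ⟨M, hM⟩ => ⟨M, fun g hg => hM g (hst hg)⟩) ?_ ?_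
    · rintro s t ⟨M, hM⟩ ⟨N, hN⟩
      refine ⟨max M N, fun g hg => ?_⟩
      rcases hg with hg | hg
      · exact (hM g hg).trans (le_max_left _ _)
      · exact (hN g hg).trans (le_max_right _ _)
    · intro g₀ _
      have h1 : Filter.Tendsto (fun g => g₀⁻¹ * g) (𝓝 g₀) (𝓝 1) := by
        have : Continuous fun g : G => g₀⁻¹ * g := by fun_prop
        simpa using this.tendsto g₀
      have h2 := ((hc s).comp h1).eventually (gt_mem_nhds zero_lt_one)
      refine ⟨_, mem_nhdsWithin_of_mem_nhds h2, 2 + 2 * ψ (a g₀ s) s, fun g hg => ?_⟩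
      have h3 := hψ.quasi_triangle (a g s) (a g₀ s) s
      have h4 : ψ (a g s) (a g₀ s) = ψ (a (g₀⁻¹ * g) s) s := by
        rw [← ha g₀⁻¹ (a g s) (a g₀ s), map_mul, map_inv]
        simp
      have h5 : ψ (a (g₀⁻¹ * g) s) s < 1 := hg
      rw [h4] at h3
      linarith
  set m : ℝ := max M 1
  have hm : 0 < m := lt_max_of_lt_right one_pos
  -- Chosen so that `C * (t * m) = 1 / 2`. By `1 - exp (-u) ≤ u` the kernel varies by at most `t *
  -- m` on `K`, hence by at most `1 / 2` on the whole orbit, which bounds `ψ` by `log 2 / t`.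
  set t : ℝ := 1 / (2 * C * m) with ht
  have ht0 : 0 < t := by positivity
  refine ⟨Real.log 2 / t, fun g => ?_⟩
  have h := hK S a (fun x y => Real.exp (-(t * ψ x y))) (hψ.exp_neg ht0.le)
    (fun g x y => by rw [ha]) (fun x => by
      have := (((hc x).const_mul t).neg).rexp
      simpa [hψ.diag] using this) s (t * m) (by positivity) (fun g hg => by
      have h1 := Real.add_one_le_exp (-(t * ψ (a g s) s))
      have h2 : t * ψ (a g s) s ≤ t * m :=
        mul_le_mul_of_nonneg_left ((hM g hg).trans (le_max_left _ _)) ht0.le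
      simp only [hψ.diag, mul_zero, neg_zero, Real.exp_zero]
      linarith) g
  have h3 : C * (t * m) = 1 / 2 := by rw [ht]; field_simp
  simp only [hψ.diag, mul_zero, neg_zero, Real.exp_zero, h3] at h
  have h4 : (2 : ℝ)⁻¹ ≤ Real.exp (-(t * ψ (a g s) s)) := by linarith
  have h5 := Real.log_le_log (by norm_num) h4
  rw [Real.log_exp, Real.log_inv] at h5
  rw [le_div_iff₀ ht0]
  linarith

end PropertyT

/-! ### Property `(F_B)` implies property `(T_B)` -/

section FixedPointImpliesKazhdan

variable {G : Type u} [Group G] {B : Type w} [NormedAddCommGroup B] [NormedSpace ℝ B]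

/-- The affine isometric action with given linear part and cocycle. -/
noncomputable def affineActionOfCocycle (ρ : Representation ℝ G B) (hn : ∀ g v, ‖ρ g v‖ = ‖v‖) (b : G → B)
    (hb : ∀ g h, b (g * h) = b g + ρ g (b h)) : G →* (B ≃ᵃⁱ[ℝ] B) :=
  MonoidHom.mk' (fun g => (LinearIsometryEquiv.mk (LinearEquiv.ofLinearMap (ρ g) (ρ g⁻¹)
      (by rw [← Module.End.mul_eq_comp, ← map_mul]; simp; rfl)
      (by rw [← Module.End.mul_eq_comp, ← map_mul]; simp; rfl)) (hn g)).toAffineIsometryEquiv.trans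
        (AffineIsometryEquiv.constVAdd ℝ B (b g))) fun g h => by
    ext x
    change b (g * h) + ρ (g * h) x = b g + ρ g (b h + ρ h x)
    rw [hb, map_mul, map_add, Module.End.mul_apply]
    abel

theorem affineActionOfCocycle_apply (ρ : Representation ℝ G B) (hn : ∀ g v, ‖ρ g v‖ = ‖v‖)
    (b : G → B) (hb : ∀ g h, b (g * h) = b g + ρ g (b h)) (g : G) (x : B) :
    affineActionOfCocycle ρ hn b hb g x = b g + ρ g x := rfl

/-- Changing `v` by an invariant vector does not change its displacement, so a representative of
nearly minimal norm may be used. -/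
theorem norm_orbit_sub_le_quotient {ρ : Representation ℝ G B} (hn : ∀ g v, ‖ρ g v‖ = ‖v‖) (g : G)
    (v : B) : ‖ρ g v - v‖ ≤ 2 * ‖(Submodule.Quotient.mk v : B ⧸ ρ.invariants)‖ := by
  refine le_of_forall_pos_le_add fun η hη => ?_
  obtain ⟨m, hm, hlt⟩ := Submodule.Quotient.norm_mk_lt
    (Submodule.Quotient.mk v : B ⧸ ρ.invariants) (half_pos hη)
  have h1 : m - v ∈ ρ.invariants := (Submodule.Quotient.eq _).1 hm
  have h2 : ρ g v - v = ρ g m - m := by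
    have := (ρ.mem_invariants _).1 h1 g
    rw [map_sub] at this
    rw [sub_eq_sub_iff_add_eq_add] at this ⊢
    rw [add_comm (ρ g v), ← this, add_comm]
  rw [h2]
  have := norm_sub_le (ρ g m) m
  rw [hn] at this
  linarith

/-- Displacement is controlled by displacement modulo invariant vectors, since a bounded
homomorphism into a normed space vanishes. -/
theorem norm_orbit_sub_le_quotient_orbit {ρ : Representation ℝ G B}
    (hn : ∀ g v, ‖ρ g v‖ = ‖v‖) (g : G) (v : B) :
    ‖ρ g v - v‖ ≤ 2 * ‖quotientByInvariants ρ g (Submodule.Quotient.mk v) -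
      Submodule.Quotient.mk v‖ := by
  refine le_of_forall_pos_le_add fun η hη => ?_
  have e : quotientByInvariants ρ g (Submodule.Quotient.mk v) - Submodule.Quotient.mk v =
    (Submodule.Quotient.mk (ρ g v - v) : B ⧸ ρ.invariants) := rfl
  rw [e]
  obtain ⟨c, hm, hlt⟩ := Submodule.Quotient.norm_mk_lt
    (Submodule.Quotient.mk (ρ g v - v) : B ⧸ ρ.invariants) (half_pos hη)
  set q := ‖(Submodule.Quotient.mk (ρ g v - v) : B ⧸ ρ.invariants)‖
  have hw : ρ g v - v - c ∈ ρ.invariants := (Submodule.Quotient.eq _).1 hm.symm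
  set w := ρ g v - v - c with hwdef
  have hvw : ρ g v - v = c + w := by rw [hwdef]; abel
  -- Telescoping along powers of `g`: each step contributes the invariant vector `w` and an
  -- isometric image of `c`. Since the total is at most `2 ‖v‖`, dividing by a large `n` gives `‖w‖
  -- ≤ ‖c‖`.
  have key : ∀ n : ℕ, ‖ρ (g ^ n) v - v - n • w‖ ≤ n * ‖c‖ := by
    intro n
    induction n with
    | zero => simp
    | succ n ih =>
      have : ρ (g ^ (n + 1)) v - v - (n + 1) • w = ρ (g ^ n) c + (ρ (g ^ n) v - v - n • w) := by
        have h1 : ρ (g ^ n) (ρ g v - v) = ρ (g ^ n) c + w := by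
          rw [hvw, map_add, (ρ.mem_invariants _).1 hw]
        rw [map_sub, ← Module.End.mul_apply, ← map_mul, ← pow_succ, sub_eq_iff_eq_add] at h1
        rw [h1, succ_nsmul]; abel
      rw [this]
      refine (norm_add_le _ _).trans ?_
      rw [hn]
      push_cast
      linarith
  have hwn : ‖w‖ ≤ ‖c‖ := by
    by_contra! hlt'
    obtain ⟨n, hnn⟩ := exists_nat_gt (2 * ‖v‖ / (‖w‖ - ‖c‖))
    rw [div_lt_iff₀ (by linarith)] at hnn
    have h1 : ‖n • w‖ ≤ ‖ρ (g ^ n) v‖ + ‖v‖ + ‖ρ (g ^ n) v - v - n • w‖ := by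
      have : n • w = ρ (g ^ n) v - v - (ρ (g ^ n) v - v - n • w) := by abel
      nth_rewrite 1 [this]
      exact (norm_sub_le _ _).trans (by gcongr; exact norm_sub_le _ _)
    rw [hn, ← Nat.cast_smul_eq_nsmul ℝ, norm_smul, Real.norm_natCast,
      Nat.cast_smul_eq_nsmul ℝ] at h1
    have := key n
    linarith
  rw [hvw]
  have := norm_add_le c w
  linarith

variable [TopologicalSpace G]

/-- A fixed point `x` of the affine action with cocycle `b` exhibits `b` as the coboundary of `-x`.
For isometries, continuity of orbit maps already gives joint continuity. -/
theorem HasPropertyFB.cocycle_eq (hF : HasPropertyFB G B) {ρ : Representation ℝ G B}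
    (hρ : IsIsometricRep ρ) {b : G → B} (hb : ∀ g h, b (g * h) = b g + ρ g (b h))
    (hc : Continuous b) : ∃ v, ∀ g, ρ g v - v = b g := by
  obtain ⟨x, hx⟩ := hF (affineActionOfCocycle ρ hρ.norm_map b hb) (by
    simp only [affineActionOfCocycle_apply]
    refine (hc.comp continuous_fst).add (continuous_iff_continuousAt.2 fun ⟨g₀, x₀⟩ => ?_)
    rw [ContinuousAt, tendsto_iff_norm_sub_tendsto_zero]
    have h1 : Continuous fun q : G × B => ‖q.2 - x₀‖ + ‖ρ q.1 x₀ - ρ g₀ x₀‖ :=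
      (continuous_snd.sub continuous_const).norm.add
        (((hρ.continuous_orbit x₀).comp continuous_fst).sub continuous_const).norm
    have h2 := h1.tendsto (g₀, x₀)
    simp only [sub_self, norm_zero, add_zero] at h2
    refine squeeze_zero (fun _ => norm_nonneg _) (fun q => ?_) h2
    have : ρ q.1 q.2 - ρ g₀ x₀ = ρ q.1 (q.2 - x₀) + (ρ q.1 x₀ - ρ g₀ x₀) := by
      rw [map_sub]; abel
    dsimp only
    rw [this]
    refine (norm_add_le _ _).trans ?_
    rw [hρ.norm_map])
  refine ⟨-x, fun g => ?_⟩
  have := hx g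
  rw [affineActionOfCocycle_apply] at this
  rw [map_neg]
  nth_rewrite 2 [← this]
  abel

theorem IsIsometricRep.isClosed_invariants {ρ : Representation ℝ G B} (hρ : IsIsometricRep ρ) :
    IsClosed (ρ.invariants : Set B) := by
  have : (ρ.invariants : Set B) = ⋂ g : G, {v | ρ g v = v} := by
    ext v; simp
  rw [this]
  exact isClosed_iInter fun g =>
    isClosed_eq (LinearIsometry.mk (ρ g) (hρ.norm_map g)).continuous continuous_id

theorem AlmostHasInvariantVectors.exists_small_displacement [IsTopologicalGroup G] {ρ : Representation ℝ G B}
    (hρ : IsIsometricRep ρ) (h : AlmostHasInvariantVectors (quotientByInvariants ρ)) {K : Set G}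
    (hK : IsCompact K) {r : ℝ} (hr : 0 < r) :
    ∃ v : B, ‖(Submodule.Quotient.mk v : B ⧸ ρ.invariants)‖ = r ∧ ∀ g ∈ K, ‖ρ g v - v‖ ≤ 1 := by
  -- With `1` inserted, the diameter controls the displacement. The value `(2 * r)⁻¹` pays for the
  -- scaling by `r` and for the factor `2` in passing from the quotient to `B`.
  obtain ⟨x, hx, hd⟩ := h (insert 1 K) (hK.insert 1) ((2 * r)⁻¹) (by positivity)
  obtain ⟨v, rfl⟩ := Submodule.Quotient.mk_surjective _ x
  refine ⟨r • v, ?_, fun g hg => ?_⟩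
  · rw [Submodule.Quotient.mk_smul, norm_smul, hx, mul_one, Real.norm_of_nonneg hr.le]
  -- `Metric.diam` is zero on unbounded sets, so a small diameter says nothing without this.
  · have hb : Bornology.IsBounded ((fun g => quotientByInvariants ρ g (Submodule.Quotient.mk v)) ''
        insert 1 K) := by
      refine isBounded_iff_forall_norm_le.2 ⟨‖v‖, ?_⟩
      rintro _ ⟨g, -, rfl⟩
      change ‖(Submodule.Quotient.mk (ρ g v) : B ⧸ ρ.invariants)‖ ≤ _
      exact (Submodule.Quotient.norm_mk_le _ _).trans_eq (hρ.norm_map g v)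
    have h1 := Metric.dist_le_diam_of_mem hb (Set.mem_image_of_mem _ (Set.mem_insert_of_mem 1 hg))
      (Set.mem_image_of_mem _ (Set.mem_insert 1 K))
    simp only [map_one, Module.End.one_apply] at h1
    rw [dist_eq_norm] at h1
    have h2 := norm_orbit_sub_le_quotient_orbit hρ.norm_map g v
    rw [map_smul, ← smul_sub, norm_smul, Real.norm_of_nonneg hr.le]
    have h3 : ‖ρ g v - v‖ ≤ 2 * (2 * r)⁻¹ := by linarith
    calc r * ‖ρ g v - v‖ ≤ r * (2 * (2 * r)⁻¹) := by gcongr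
      _ = 1 := by field_simp

theorem HasPropertyFB.hasPropertyTB [IsTopologicalGroup G] [LocallyCompactSpace G]
    [SecondCountableTopology G] [CompleteSpace B] (hF : HasPropertyFB G B) : HasPropertyTB G B := by
  intro ρ hρ hA
  have hcl := hρ.isClosed_invariants
  let K := CompactExhaustion.choice G
  choose u hu1 hu2 using fun n : ℕ => hA.exists_small_displacement hρ (K.isCompact n)
    (show (0 : ℝ) < n + 1 by positivity)
  have hbd : ∀ m : ℕ, ∃ C : ℝ, ∀ g ∈ K m, ∀ n, ‖ρ g (u n) - u n‖ ≤ C := by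
    intro m
    -- The bound `1` serves for `n ≥ m`, where `K m ⊆ K n`; the sum covers the finitely many other
    -- indices.
    refine ⟨1 + ∑ n ∈ Finset.range m, 2 * ‖u n‖, fun g hg n => ?_⟩
    have hnn : ∀ n ∈ Finset.range m, 0 ≤ 2 * ‖u n‖ := fun n _ => by positivity
    rcases lt_or_ge n m with hnm | hnm
    · have h1 := norm_sub_le (ρ g (u n)) (u n)
      rw [hρ.norm_map] at h1
      have h2 := Finset.single_le_sum hnn (Finset.mem_range.2 hnm)
      linarith
    · have h1 := hu2 n g (K.subset hnm hg)
      have h2 := Finset.sum_nonneg hnn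
      linarith
  let E := lp (fun _ : ℕ => ℝ) 1
  have hE : ∀ a : E, Summable fun n => ‖a n‖ := fun a => by
    have := (lp.memℓp a).summable (by norm_num)
    simpa using this
  have hEn : ∀ a : E, ‖a‖ = ∑' n, ‖a n‖ := fun a => by
    have := lp.norm_eq_tsum_rpow (p := 1) (by norm_num) a
    simpa using this
  let t : E → G → ℕ → B := fun a g n => a n • (ρ g (u n) - u n)
  let b : E → G → B := fun a g => ∑' n, t a g n
  have htn : ∀ (a : E) m, ∃ C : ℝ, ∀ g ∈ K m, ∀ a n, ‖t a g n‖ ≤ ‖a n‖ * C := fun a m => by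
    obtain ⟨C, hC⟩ := hbd m
    refine ⟨C, fun g hg a n => ?_⟩
    rw [norm_smul]
    gcongr
    exact hC g hg n
  have hsum : ∀ a g, Summable (t a g) := fun a g => by
    obtain ⟨m, hm⟩ := K.exists_mem g
    obtain ⟨C, hC⟩ := htn a m
    exact Summable.of_norm_bounded ((hE a).mul_right C) (hC g hm a)
  have hb : ∀ a g h, b a (g * h) = b a g + ρ g (b a h) := fun a g h => by
    have h1 : ρ g (b a h) = ∑' n, ρ g (t a h n) :=
      (LinearIsometry.mk (ρ g) (hρ.norm_map g)).toContinuousLinearMap.map_tsum (hsum a h)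
    have h2 : Summable fun n => ρ g (t a h n) :=
      (LinearIsometry.mk (ρ g) (hρ.norm_map g)).toContinuousLinearMap.summable (hsum a h)
    rw [h1, ← (hsum a g).tsum_add h2]
    refine tsum_congr fun n => ?_
    simp only [t]
    rw [map_smul, ← smul_add, map_sub, map_mul, Module.End.mul_apply]
    congr 1; abel
  have hbc : ∀ a, Continuous (b a) := fun a => by
    refine continuous_iff_continuousAt.2 fun g => ?_
    obtain ⟨m, hm⟩ := K.exists_mem g
    obtain ⟨C, hC⟩ := htn a (m + 1)
    have h1 : ContinuousOn (b a) (K (m + 1)) := continuousOn_tsum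
      (fun n => (((hρ.continuous_orbit (u n)).sub continuous_const).const_smul _).continuousOn)
      ((hE a).mul_right C) fun n g hg => hC g hg a n
    exact h1.continuousAt (mem_interior_iff_mem_nhds.1 (K.subset_interior_succ m hm))
  choose V hV using fun a => hF.cocycle_eq hρ (hb a) (hbc a)
  have hbadd : ∀ a a' g, b (a + a') g = b a g + b a' g := fun a a' g => by
    simp only [b]
    rw [← (hsum a g).tsum_add (hsum a' g)]
    exact tsum_congr fun n => add_smul _ _ _
  have hbsmul : ∀ (c : ℝ) a g, b (c • a) g = c • b a g := fun c a g => by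
    simp only [b]
    rw [← (hsum a g).tsum_const_smul c]
    exact tsum_congr fun n => mul_smul _ _ _
  have hmk : ∀ x y : B, (∀ g, ρ g x - x = ρ g y - y) →
      (Submodule.Quotient.mk x : B ⧸ ρ.invariants) = Submodule.Quotient.mk y := fun x y h => by
    refine (Submodule.Quotient.eq _).2 fun g => ?_
    rw [map_sub, sub_eq_sub_iff_sub_eq_sub]
    exact h g
  -- The primitives `V a` are arbitrary choices, but they are unique modulo invariants, so their
  -- classes depend linearly on `a`.
  let L : E →ₗ[ℝ] B ⧸ ρ.invariants :=
    { toFun := fun a => Submodule.Quotient.mk (V a)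
      map_add' := fun a a' => by
        rw [← Submodule.Quotient.mk_add]
        refine hmk _ _ fun g => ?_
        rw [hV, hbadd, ← hV, ← hV, map_add]; abel
      map_smul' := fun c a => by
        rw [RingHom.id_apply, ← Submodule.Quotient.mk_smul]
        refine hmk _ _ fun g => ?_
        rw [hV, hbsmul, ← hV, map_smul, smul_sub] }
  -- Closed graph theorem: for fixed `g`, both the cocycle `b a g` and the displacement of a class
  -- under `g` are continuous, so limits can be compared.
  have hL : Continuous L := by
    refine L.continuous_of_seq_closed_graph fun a x y hax hLy => ?_
    obtain ⟨y, rfl⟩ := Submodule.Quotient.mk_surjective _ y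
    refine hmk _ _ fun g => ?_
    rw [hV]
    obtain ⟨m, hm⟩ := K.exists_mem g
    obtain ⟨C, hC⟩ := htn x m
    have h1 : Filter.Tendsto (fun k => b (a k) g) Filter.atTop (𝓝 (b x g)) := by
      rw [tendsto_iff_norm_sub_tendsto_zero]
      have h2 := ((tendsto_iff_norm_sub_tendsto_zero.1 hax).mul_const C)
      rw [zero_mul] at h2
      refine squeeze_zero (fun _ => norm_nonneg _) (fun k => ?_) h2
      have h3 : b (a k) g - b x g = b (a k - x) g := by
        rw [sub_eq_iff_eq_add, ← hbadd, sub_add_cancel]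
      rw [h3, hEn, ← tsum_mul_right]
      exact tsum_of_norm_bounded ((hE (a k - x)).mul_right C).hasSum (hC g hm _)
    have h2 : Filter.Tendsto (fun k => b (a k) g) Filter.atTop (𝓝 (ρ g y - y)) := by
      rw [tendsto_iff_norm_sub_tendsto_zero]
      have h3 := (tendsto_iff_norm_sub_tendsto_zero.1 hLy).const_mul 2
      rw [mul_zero] at h3
      refine squeeze_zero (fun _ => norm_nonneg _) (fun k => ?_) h3
      have h4 : b (a k) g - (ρ g y - y) = ρ g (V (a k) - y) - (V (a k) - y) := by
        rw [← hV, map_sub]; abel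
      rw [h4]
      exact norm_orbit_sub_le_quotient hρ.norm_map g _
    exact tendsto_nhds_unique h2 h1
  let L' : E →L[ℝ] B ⧸ ρ.invariants := ⟨L, hL⟩
  obtain ⟨n, hn⟩ := exists_nat_gt ‖L'‖
  have h1 := L'.le_opNorm (lp.single 1 n (1 : ℝ))
  rw [lp.norm_single (by norm_num), norm_one, mul_one] at h1
  have h2 : L' (lp.single 1 n (1 : ℝ)) = Submodule.Quotient.mk (u n) := by
    refine hmk _ _ fun g => ?_
    rw [hV]
    simp only [b, t]
    rw [tsum_eq_single n]
    · simp
    · intro k hk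
      simp [hk]
  rw [h2, hu1] at h1
  linarith

end FixedPointImpliesKazhdan

/-! ### Inequalities for powers of absolute values -/

section ScalarInequalities

theorem rpow_midpoint_le {p : ℝ} (hp : 1 ≤ p) {a b : ℝ} (ha : 0 ≤ a) (hb : 0 ≤ b) :
    (1 / 2 * a + 1 / 2 * b) ^ p ≤ 1 / 2 * a ^ p + 1 / 2 * b ^ p := by
  simpa only [smul_eq_mul] using (convexOn_rpow hp).2 ha hb (show (0 : ℝ) ≤ 1 / 2 by norm_num)
    (show (0 : ℝ) ≤ 1 / 2 by norm_num) (by norm_num)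

theorem abs_midpoint_rpow_le {p : ℝ} (hp : 1 ≤ p) (a b : ℝ) :
    |(a + b) / 2| ^ p ≤ (|a| ^ p + |b| ^ p) / 2 := by
  have h1 : |(a + b) / 2| ≤ 1 / 2 * |a| + 1 / 2 * |b| := by
    rw [abs_div, abs_two]; linarith [abs_add_le a b]
  have h2 := rpow_midpoint_le hp (abs_nonneg a) (abs_nonneg b)
  have h3 := Real.rpow_le_rpow (abs_nonneg _) h1 (by linarith : 0 ≤ p)
  linarith

theorem abs_midpoint_rpow_lt {p : ℝ} (hp : 1 < p) {a b : ℝ} (hab : a ≠ b) :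
    |(a + b) / 2| ^ p < (|a| ^ p + |b| ^ p) / 2 := by
  by_cases h : |a| = |b|
  · rcases abs_eq_abs.1 h with h | h
    · exact absurd h hab
    · have hb : b ≠ 0 := fun hb => hab (by rw [h, hb, neg_zero])
      rw [h, neg_add_cancel, zero_div, abs_zero, Real.zero_rpow (by linarith), abs_neg]
      have := Real.rpow_pos_of_pos (abs_pos.2 hb) p
      linarith
  · have h1 : |(a + b) / 2| ≤ (1 / 2 : ℝ) • |a| + (1 / 2 : ℝ) • |b| := by
      rw [abs_div, abs_two]; simp only [smul_eq_mul]; linarith [abs_add_le a b]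
    have h2 := (strictConvexOn_rpow hp).2 (abs_nonneg a) (abs_nonneg b) h
      (show (0 : ℝ) < 1 / 2 by norm_num) (show (0 : ℝ) < 1 / 2 by norm_num) (by norm_num)
    have h3 := Real.rpow_le_rpow (abs_nonneg _) h1 (by linarith : 0 ≤ p)
    simp only [smul_eq_mul] at h2 h3
    linarith

/-- Quantitative strict convexity. By homogeneity it is enough to treat the unit sphere of the
plane; on the compact part where `|a - b| ^ p` is at least the `η` term, `a ≠ b`, so the convexity
defect has a positive minimum. -/
theorem exists_abs_sub_rpow_le {p : ℝ} (hp : 1 < p) {η : ℝ} (hη : 0 < η) :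
    ∃ C : ℝ, 0 < C ∧ ∀ a b : ℝ, |a - b| ^ p ≤ η * (|a| ^ p + |b| ^ p) +
      C * ((|a| ^ p + |b| ^ p) / 2 - |(a + b) / 2| ^ p) := by
  have hp0 : 0 < p := by linarith
  let D : ℝ × ℝ → ℝ := fun q => (|q.1| ^ p + |q.2| ^ p) / 2 - |(q.1 + q.2) / 2| ^ p
  let F : ℝ × ℝ → ℝ := fun q => |q.1 - q.2| ^ p - η * (|q.1| ^ p + |q.2| ^ p)
  have hr : ∀ f : ℝ × ℝ → ℝ, Continuous f → Continuous fun q => |f q| ^ p := fun f hf =>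
    hf.abs.rpow_const fun _ => Or.inr hp0.le
  have h1 := hr _ continuous_fst
  have h2 := hr _ continuous_snd
  have hD : Continuous D := ((h1.add h2).div_const 2).sub
    (hr _ ((continuous_fst.add continuous_snd).div_const 2))
  have hF : Continuous F := (hr _ (continuous_fst.sub continuous_snd)).sub
    ((h1.add h2).const_mul η)
  have hK : IsCompact (Metric.sphere (0 : ℝ × ℝ) 1 ∩ {q | 0 ≤ F q}) :=
    (isCompact_sphere _ _).inter_right (isClosed_le continuous_const hF)
  have key : ∃ C : ℝ, 0 < C ∧ ∀ q ∈ Metric.sphere (0 : ℝ × ℝ) 1, F q ≤ C * D q := by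
    have hD0 : ∀ q, 0 ≤ D q := fun q => sub_nonneg.2 (abs_midpoint_rpow_le hp.le _ _)
    rcases (Metric.sphere (0 : ℝ × ℝ) 1 ∩ {q | 0 ≤ F q}).eq_empty_or_nonempty with he | hne
    · refine ⟨1, one_pos, fun q hq => ?_⟩
      have : q ∉ {q | 0 ≤ F q} := fun h => Set.eq_empty_iff_forall_notMem.1 he q ⟨hq, h⟩
      have h3 : F q < 0 := not_le.1 this
      linarith [hD0 q]
    · obtain ⟨q₀, hq₀, hmin⟩ := hK.exists_isMinOn hne hD.continuousOn
      obtain ⟨q₁, hq₁, hmax⟩ := hK.exists_isMaxOn hne hF.continuousOn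
      have hpos : 0 < D q₀ := by
        refine sub_pos.2 (abs_midpoint_rpow_lt hp fun h => ?_)
        have h3 : 0 ≤ F q₀ := hq₀.2
        simp only [F, h, sub_self, abs_zero, Real.zero_rpow hp0.ne'] at h3
        have h4 : |q₀.2| = 0 := by
          by_contra h5
          have h6 := Real.rpow_pos_of_pos (lt_of_le_of_ne (abs_nonneg _) (Ne.symm h5)) p
          have h7 := mul_pos hη (add_pos h6 h6)
          linarith
        have h8 : q₀ = 0 := Prod.ext (by rw [h]; exact abs_eq_zero.1 h4) (abs_eq_zero.1 h4)
        have h9 := hq₀.1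
        rw [h8] at h9
        simp at h9
      refine ⟨(F q₁ + 1) / D q₀, div_pos (by linarith [hq₁.2.out]) hpos, fun q hq => ?_⟩
      by_cases hq' : 0 ≤ F q
      · have h3 : D q₀ ≤ D q := hmin ⟨hq, hq'⟩
        have h4 : F q ≤ F q₁ := hmax ⟨hq, hq'⟩
        have h5 : 0 ≤ F q₁ := hq₁.2
        rw [div_mul_eq_mul_div, le_div_iff₀ hpos]
        nlinarith
      · have h5 : 0 ≤ F q₁ := hq₁.2
        have : 0 ≤ (F q₁ + 1) / D q₀ * D q := mul_nonneg (div_nonneg (by linarith) hpos.le) (hD0 q)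
        linarith
  obtain ⟨C, hC, h⟩ := key
  refine ⟨C, hC, fun a b => ?_⟩
  rcases eq_or_ne (a, b) 0 with h0 | h0
  · obtain ⟨rfl, rfl⟩ := Prod.mk_eq_zero.1 h0
    simp [Real.zero_rpow hp0.ne']
  · have hn := norm_pos_iff.2 h0
    set l := ‖(a, b)‖
    have h3 := h (l⁻¹ • (a, b)) (by
      rw [mem_sphere_zero_iff_norm, norm_smul, norm_inv, norm_norm, inv_mul_cancel₀ hn.ne'])
    have hs : ∀ x y : ℝ, |x| = l * |y| → |x| ^ p = l ^ p * |y| ^ p := fun x y hxy => by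
      rw [hxy, Real.mul_rpow hn.le (abs_nonneg _)]
    have hs' : ∀ x : ℝ, |x| = l * |l⁻¹ * x| := fun x => by
      rw [abs_mul, abs_of_pos (inv_pos.2 hn), mul_inv_cancel_left₀ hn.ne']
    have e1 := hs a _ (hs' a)
    have e2 := hs b _ (hs' b)
    have e3 := hs (a - b) (l⁻¹ * a - l⁻¹ * b) (by rw [hs' (a - b), mul_sub])
    have e4 := hs ((a + b) / 2) ((l⁻¹ * a + l⁻¹ * b) / 2)
      (by rw [hs' ((a + b) / 2), ← mul_add, mul_div_assoc])
    simp only [F, D, Prod.smul_fst, Prod.smul_snd, smul_eq_mul] at h3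
    rw [e1, e2, e3, e4]
    have h4 := mul_le_mul_of_nonneg_left h3 (Real.rpow_nonneg hn.le p)
    linarith

/-- A weak form of Clarkson's inequality for `2 ≤ p ≤ 3`. -/
theorem abs_midpoint_rpow_add_le {p : ℝ} (h2 : 2 ≤ p) (h3 : p ≤ 3) (a b : ℝ) :
    |(a + b) / 2| ^ p + |a - b| ^ p / 8 ≤ (|a| ^ p + |b| ^ p) / 2 := by
  have hsq : ∀ x : ℝ, |x| ^ p = (x ^ 2) ^ (p / 2) := fun x => by
    rw [← sq_abs, ← Real.rpow_natCast, ← Real.rpow_mul (abs_nonneg _)]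
    congr 1; push_cast; ring
  have h8 : |a - b| ^ p / 8 ≤ |(a - b) / 2| ^ p := by
    rw [abs_div, abs_two, Real.div_rpow (abs_nonneg _) (by norm_num)]
    have : (2 : ℝ) ^ p ≤ 8 := by
      calc (2 : ℝ) ^ p ≤ 2 ^ (3 : ℝ) := Real.rpow_le_rpow_of_exponent_le (by norm_num) h3
        _ = 8 := by norm_num
    gcongr
  -- The power `p / 2 ≥ 1` is superadditive and convex on nonnegative reals; both facts are applied
  -- to the parallelogram identity `e`.
  have h4 := Real.add_rpow_le_rpow_add (sq_nonneg ((a + b) / 2)) (sq_nonneg ((a - b) / 2))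
    (show 1 ≤ p / 2 by linarith)
  have h5 := rpow_midpoint_le (show 1 ≤ p / 2 by linarith) (sq_nonneg a) (sq_nonneg b)
  have e : ((a + b) / 2) ^ 2 + ((a - b) / 2) ^ 2 = 1 / 2 * a ^ 2 + 1 / 2 * b ^ 2 := by ring
  rw [e] at h4
  rw [hsq a, hsq b]
  rw [← hsq, ← hsq] at h4
  linarith

/-- For `p` close to `2`, the kernel `|s - t| ^ p` is almost conditionally of negative type. -/
theorem kernelForm_abs_sub_rpow_le {S : Type*} (c : S →₀ ℝ) (hc : ∑ i ∈ c.support, c i = 0)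
    {η : ℝ} (hη : 0 < η) : ∃ δ > 0, ∀ p : ℝ, 2 ≤ p → p < 2 + δ → ∀ f : S → ℝ,
      kernelForm (fun i j => |f i - f j| ^ p) c ≤ η * ∑ i ∈ c.support, |f i| ^ p := by
  set A : ℝ := ∑ i ∈ c.support, ∑ j ∈ c.support, |c i * c j| with hA
  have hA0 : 0 ≤ A := Finset.sum_nonneg fun _ _ => Finset.sum_nonneg fun _ _ => abs_nonneg _
  set η' : ℝ := η / (A + 1) with hη'
  have hη'0 : 0 < η' := by positivity
  -- As `p → 2`, `u ^ p` tends to `u ^ 2` uniformly on `[0, 2]`. After division by `M = max |f i|`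
  -- all differences lie there, so the form is `M ^ p` times one of negative type, up to an error `A
  -- * η' * M ^ p ≤ η * M ^ p`.
  have huc : UniformContinuousOn (fun q : ℝ × ℝ => q.1 ^ q.2) (Set.Icc 0 2 ×ˢ Set.Icc 2 3) := by
    refine (isCompact_Icc.prod isCompact_Icc).uniformContinuousOn_of_continuous ?_
    intro q hq
    refine (Real.continuousAt_rpow q (Or.inr ?_)).continuousWithinAt
    linarith [hq.2.1]
  obtain ⟨δ, hδ, h⟩ := Metric.uniformContinuousOn_iff.1 huc η' hη'0
  refine ⟨min δ 1, lt_min hδ one_pos, fun p hp2 hp f => ?_⟩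
  have hpδ : p < 2 + δ := hp.trans_le (by gcongr; exact min_le_left _ _)
  have hp3 : p ≤ 3 := by have := min_le_right δ 1; linarith
  have hw : ∀ u : ℝ, 0 ≤ u → u ≤ 2 → |u ^ p - u ^ 2| ≤ η' := fun u h0 h2 => by
    have := h (u, p) ⟨⟨h0, h2⟩, hp2, hp3⟩ (u, 2) ⟨⟨h0, h2⟩, le_rfl, by norm_num⟩ (by
      rw [Prod.dist_eq, dist_self, Real.dist_eq, max_lt_iff]
      refine ⟨hδ, abs_lt.2 ⟨by linarith, by linarith⟩⟩)
    simp only [Real.dist_eq, Real.rpow_two] at this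
    exact this.le
  rcases c.support.eq_empty_or_nonempty with he | hne
  · simp [kernelForm, he]
  obtain ⟨i₀, hi₀, hmax⟩ := c.support.exists_max_image (fun i => |f i|) hne
  set M := |f i₀|
  have hMs : M ^ p ≤ ∑ i ∈ c.support, |f i| ^ p :=
    Finset.single_le_sum (f := fun i => |f i| ^ p) (fun i _ => Real.rpow_nonneg (abs_nonneg _) _) hi₀
  rcases (abs_nonneg (f i₀)).eq_or_lt with hM | hM
  · have hf0 : ∀ i ∈ c.support, f i = 0 := fun i hi =>
      abs_eq_zero.1 (le_antisymm ((hmax i hi).trans hM.symm.le) (abs_nonneg _))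
    have : kernelForm (fun i j => |f i - f j| ^ p) c = 0 := by
      refine Finset.sum_eq_zero fun i hi => Finset.sum_eq_zero fun j hj => ?_
      dsimp only
      rw [hf0 i hi, hf0 j hj, sub_self, abs_zero, Real.zero_rpow (by linarith), mul_zero]
    rw [this]
    exact mul_nonneg hη.le (Finset.sum_nonneg fun _ _ => Real.rpow_nonneg (abs_nonneg _) _)
  · have hterm : ∀ i ∈ c.support, ∀ j ∈ c.support, c i * c j * |f i - f j| ^ p ≤
        M ^ p * (c i * c j * (f i / M - f j / M) ^ 2) + |c i * c j| * (M ^ p * η') := by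
      intro i hi j hj
      have hu : |f i - f j| / M ≤ 2 := by
        rw [div_le_iff₀ hM]
        have := abs_sub (f i) (f j)
        linarith [hmax i hi, hmax j hj]
      have h1 := hw _ (div_nonneg (abs_nonneg _) hM.le) hu
      have h2 : |f i - f j| ^ p = M ^ p * (|f i - f j| / M) ^ p := by
        rw [← Real.mul_rpow hM.le (div_nonneg (abs_nonneg _) hM.le), mul_div_cancel₀ _ hM.ne']
      have h3 : (f i / M - f j / M) ^ 2 = (|f i - f j| / M) ^ 2 := by
        rw [← sub_div, div_pow, div_pow, sq_abs (f i - f j)]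
      rw [h2, h3]
      have h4 : c i * c j * ((|f i - f j| / M) ^ p - (|f i - f j| / M) ^ 2) ≤ |c i * c j| * η' := by
        refine (le_abs_self _).trans ?_
        rw [abs_mul]
        gcongr
      have := mul_le_mul_of_nonneg_left h4 (Real.rpow_nonneg hM.le p)
      linarith
    have h5 := Finset.sum_le_sum fun i hi => Finset.sum_le_sum (hterm i hi)
    simp only [Finset.sum_add_distrib, ← Finset.mul_sum, ← Finset.sum_mul] at h5
    have h6 := (isCondNegKernel_sq_sub fun i => f i / M).nonpos c hc
    rw [kernelForm] at h6
    have h7 := mul_nonpos_of_nonneg_of_nonpos (Real.rpow_nonneg hM.le p) h6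
    rw [← hA] at h5
    have h8 : A * (M ^ p * η') ≤ η * M ^ p := by
      have : A * η' ≤ η := by
        rw [hη', mul_div_assoc', div_le_iff₀ (by positivity)]
        nlinarith
      nlinarith [Real.rpow_nonneg hM.le p]
    have h9 := mul_le_mul_of_nonneg_left hMs hη.le
    rw [kernelForm]
    linarith

end ScalarInequalities

/-! ### Integrating the scalar inequalities over `L^p` -/

section LpSpace

variable {X : Type*} [MeasurableSpace X] {μ : Measure X} {p : ℝ≥0∞}

theorem integrable_abs_rpow_coeFn (hp0 : p ≠ 0) (hp : p ≠ ∞) (f : Lp ℝ p μ) :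
    Integrable (fun x => |f x| ^ p.toReal) μ := by
  simpa using (Lp.memLp f).integrable_norm_rpow hp0 hp

theorem Lp_norm_rpow_eq_integral (hp0 : p ≠ 0) (hp : p ≠ ∞) (f : Lp ℝ p μ) :
    ‖f‖ ^ p.toReal = ∫ x, |f x| ^ p.toReal ∂μ := by
  have h0 : 0 ≤ ∫ x, |f x| ^ p.toReal ∂μ := integral_nonneg fun x => Real.rpow_nonneg (abs_nonneg _) _
  rw [Lp.norm_def, (Lp.memLp f).eLpNorm_eq_integral_rpow_norm hp0 hp]
  simp only [Real.norm_eq_abs]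
  rw [ENNReal.toReal_ofReal (Real.rpow_nonneg h0 _), ← Real.rpow_mul h0,
    inv_mul_cancel₀ (ENNReal.toReal_ne_zero.2 ⟨hp0, hp⟩), Real.rpow_one]

theorem integrable_abs_rpow_coeFn_sub (hp0 : p ≠ 0) (hp : p ≠ ∞) (f g : Lp ℝ p μ) :
    Integrable (fun x => |f x - g x| ^ p.toReal) μ := by
  refine (integrable_abs_rpow_coeFn hp0 hp (f - g)).congr ?_
  filter_upwards [Lp.coeFn_sub f g] with x hx
  rw [hx, Pi.sub_apply]

theorem Lp_norm_sub_rpow_eq_integral (hp0 : p ≠ 0) (hp : p ≠ ∞) (f g : Lp ℝ p μ) :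
    ‖f - g‖ ^ p.toReal = ∫ x, |f x - g x| ^ p.toReal ∂μ := by
  rw [Lp_norm_rpow_eq_integral hp0 hp]
  refine integral_congr_ae ?_
  filter_upwards [Lp.coeFn_sub f g] with x hx
  rw [hx, Pi.sub_apply]

/-- Reduces inequalities for kernel forms on `L^p` to pointwise inequalities between scalars. -/
theorem kernelForm_Lp (hp0 : p ≠ 0) (hp : p ≠ ∞) {S : Type*} (F : S → Lp ℝ p μ) (c : S →₀ ℝ) :
    kernelForm (fun i j => ‖F i - F j‖ ^ p.toReal) c =
      ∫ x, kernelForm (fun i j => |F i x - F j x| ^ p.toReal) c ∂μ := by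
  simp only [kernelForm]
  have hint := fun i j => integrable_abs_rpow_coeFn_sub hp0 hp (F i) (F j)
  rw [integral_finsetSum _ fun i _ => integrable_finsetSum _ fun j _ => (hint i j).const_mul _]
  refine Finset.sum_congr rfl fun i _ => ?_
  rw [integral_finsetSum _ fun j _ => (hint i j).const_mul _]
  refine Finset.sum_congr rfl fun j _ => ?_
  rw [integral_const_mul, Lp_norm_sub_rpow_eq_integral hp0 hp]

/-- The kernel `‖f - g‖_p ^ p` on `L^p`, `0 < p ≤ 2`, is conditionally of negative type. -/
theorem isCondNegKernel_Lp (hp0 : p ≠ 0) (hp2 : p ≤ 2) :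
    IsCondNegKernel fun f g : Lp ℝ p μ => ‖f - g‖ ^ p.toReal := by
  have hp : p ≠ ∞ := ne_top_of_le_ne_top ENNReal.ofNat_ne_top hp2
  have hr0 : 0 < p.toReal := ENNReal.toReal_pos hp0 hp
  refine ⟨fun f g => ?_, fun f => ?_, fun c hc => ?_⟩
  · rw [Lp_norm_sub_rpow_eq_integral hp0 hp, Lp_norm_sub_rpow_eq_integral hp0 hp]
    simp only [abs_sub_comm]
  · rw [sub_self, Lp.norm_zero, Real.zero_rpow hr0.ne']
  · rw [kernelForm_Lp hp0 hp (fun f => f)]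
    refine integral_nonpos fun x => ?_
    refine (isCondNegKernel_abs_sub_rpow (fun f : Lp ℝ p μ => f x) hr0 ?_).nonpos c hc
    simpa using ENNReal.toReal_mono ENNReal.ofNat_ne_top hp2

theorem kernelForm_Lp_le (hp : p ≠ ∞) {S : Type*} (c : S →₀ ℝ) {η δ : ℝ}
    (h : ∀ p : ℝ, 2 ≤ p → p < 2 + δ → ∀ f : S → ℝ,
      kernelForm (fun i j => |f i - f j| ^ p) c ≤ η * ∑ i ∈ c.support, |f i| ^ p)
    (hp2 : 2 ≤ p) (hpδ : p.toReal < 2 + δ) (F : S → Lp ℝ p μ) :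
    kernelForm (fun i j => ‖F i - F j‖ ^ p.toReal) c ≤
      η * ∑ i ∈ c.support, ‖F i‖ ^ p.toReal := by
  have hp0 : p ≠ 0 := (lt_of_lt_of_le (by norm_num) hp2).ne'
  have hr2 : 2 ≤ p.toReal := by simpa using ENNReal.toReal_mono hp hp2
  have hint := fun i => integrable_abs_rpow_coeFn hp0 hp (F i)
  have e : η * ∑ i ∈ c.support, ‖F i‖ ^ p.toReal =
      ∫ x, η * ∑ i ∈ c.support, |F i x| ^ p.toReal ∂μ := by
    rw [integral_const_mul, integral_finsetSum _ fun i _ => hint i]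
    simp only [Lp_norm_rpow_eq_integral hp0 hp]
  rw [e, kernelForm_Lp hp0 hp]
  refine integral_mono ?_ ((integrable_finsetSum _ fun i _ => hint i).const_mul _)
    fun x => h _ hr2 hpδ fun i => F i x
  exact integrable_finsetSum _ fun i _ => integrable_finsetSum _ fun j _ =>
    (integrable_abs_rpow_coeFn_sub hp0 hp _ _).const_mul _

theorem coeFn_midpoint [Fact (1 ≤ p)] (f g : Lp ℝ p μ) :
    (((2 : ℝ)⁻¹ • (f + g) : Lp ℝ p μ) : X → ℝ) =ᵐ[μ] fun x => (f x + g x) / 2 := by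
  filter_upwards [Lp.coeFn_smul (2 : ℝ)⁻¹ (f + g), Lp.coeFn_add f g] with x h1 h2
  rw [h1, Pi.smul_apply, h2, Pi.add_apply, smul_eq_mul]; ring

theorem Lp_norm_midpoint_rpow_add_le [Fact (1 ≤ p)] (h2 : 2 ≤ p) (h3 : p ≤ 3) (f g : Lp ℝ p μ) :
    ‖(2 : ℝ)⁻¹ • (f + g)‖ ^ p.toReal + ‖f - g‖ ^ p.toReal / 8 ≤
      (‖f‖ ^ p.toReal + ‖g‖ ^ p.toReal) / 2 := by
  have hp : p ≠ ∞ := ne_top_of_le_ne_top ENNReal.ofNat_ne_top h3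
  have hp0 : p ≠ 0 := (lt_of_lt_of_le (by norm_num) h2).ne'
  have hf := integrable_abs_rpow_coeFn hp0 hp f
  have hg := integrable_abs_rpow_coeFn hp0 hp g
  have hs := integrable_abs_rpow_coeFn_sub hp0 hp f g
  have hm := integrable_abs_rpow_coeFn hp0 hp ((2 : ℝ)⁻¹ • (f + g))
  have hfg : Integrable (fun x => |f x| ^ p.toReal + |g x| ^ p.toReal) μ := hf.add hg
  rw [Lp_norm_rpow_eq_integral hp0 hp, Lp_norm_rpow_eq_integral hp0 hp f,
    Lp_norm_rpow_eq_integral hp0 hp g, Lp_norm_sub_rpow_eq_integral hp0 hp, ← integral_div,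
    ← integral_add hm (hs.div_const 8), ← integral_add hf hg, ← integral_div]
  refine integral_mono_ae (hm.add (hs.div_const 8)) (hfg.div_const 2) ?_
  filter_upwards [coeFn_midpoint f g] with x hx
  rw [hx]
  exact abs_midpoint_rpow_add_le (by simpa using ENNReal.toReal_mono hp h2)
    (by simpa using ENNReal.toReal_mono ENNReal.ofNat_ne_top h3) _ _

theorem Lp_norm_sub_rpow_le [Fact (1 ≤ p)] (hp : p ≠ ∞) {C η : ℝ}
    (h : ∀ a b : ℝ, |a - b| ^ p.toReal ≤ η * (|a| ^ p.toReal + |b| ^ p.toReal) +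
      C * ((|a| ^ p.toReal + |b| ^ p.toReal) / 2 - |(a + b) / 2| ^ p.toReal)) (f g : Lp ℝ p μ) :
    ‖f - g‖ ^ p.toReal ≤ η * (‖f‖ ^ p.toReal + ‖g‖ ^ p.toReal) +
      C * ((‖f‖ ^ p.toReal + ‖g‖ ^ p.toReal) / 2 - ‖(2 : ℝ)⁻¹ • (f + g)‖ ^ p.toReal) := by
  have hp0 : p ≠ 0 := (lt_of_lt_of_le (by norm_num) (Fact.out : 1 ≤ p)).ne'
  have hf := integrable_abs_rpow_coeFn hp0 hp f
  have hg := integrable_abs_rpow_coeFn hp0 hp g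
  have hs := integrable_abs_rpow_coeFn_sub hp0 hp f g
  have hm := integrable_abs_rpow_coeFn hp0 hp ((2 : ℝ)⁻¹ • (f + g))
  have hfg : Integrable (fun x => |f x| ^ p.toReal + |g x| ^ p.toReal) μ := hf.add hg
  have hD : Integrable (fun x => (|f x| ^ p.toReal + |g x| ^ p.toReal) / 2 -
      |((2 : ℝ)⁻¹ • (f + g) : Lp ℝ p μ) x| ^ p.toReal) μ := (hfg.div_const 2).sub hm
  have e : η * (‖f‖ ^ p.toReal + ‖g‖ ^ p.toReal) +
      C * ((‖f‖ ^ p.toReal + ‖g‖ ^ p.toReal) / 2 - ‖(2 : ℝ)⁻¹ • (f + g)‖ ^ p.toReal) =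
      ∫ x, η * (|f x| ^ p.toReal + |g x| ^ p.toReal) + C * ((|f x| ^ p.toReal +
        |g x| ^ p.toReal) / 2 - |((2 : ℝ)⁻¹ • (f + g) : Lp ℝ p μ) x| ^ p.toReal) ∂μ := by
    rw [integral_add (hfg.const_mul η) (hD.const_mul C), integral_const_mul, integral_const_mul,
      integral_sub (hfg.div_const 2) hm, integral_div, integral_add hf hg]
    simp only [Lp_norm_rpow_eq_integral hp0 hp]
  rw [e, Lp_norm_sub_rpow_eq_integral hp0 hp]
  refine integral_mono_ae hs ((hfg.const_mul η).add (hD.const_mul C)) ?_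
  filter_upwards [coeFn_midpoint f g] with x hx
  rw [hx]
  exact h _ _

theorem Lp_uniformConvexSpace [Fact (1 ≤ p)] (h1 : 1 < p) (hp : p ≠ ∞) :
    UniformConvexSpace (Lp ℝ p μ) := by
  have hr : 1 < p.toReal := by
    simpa using (ENNReal.toReal_lt_toReal ENNReal.one_ne_top hp).2 h1
  have hr0 : 0 < p.toReal := by linarith
  refine ⟨fun ε hε => ?_⟩
  have hεp := Real.rpow_pos_of_pos hε p.toReal
  -- With `η = ε ^ p / 4`, unit vectors at distance at least `ε` satisfy `ε ^ p ≤ ε ^ p / 2 + C * (1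
  -- - ‖midpoint‖ ^ p)`, whence the value of `d` below.
  obtain ⟨C, hC, h⟩ := exists_abs_sub_rpow_le hr (η := ε ^ p.toReal / 4) (by positivity)
  set d := ε ^ p.toReal / (2 * C) with hd
  have hd0 : 0 < d := by positivity
  refine ⟨2 - 2 * (max 0 (1 - d)) ^ (p.toReal)⁻¹, ?_, fun f hf g hg hfg => ?_⟩
  · have : (max 0 (1 - d)) ^ (p.toReal)⁻¹ < 1 :=
      Real.rpow_lt_one (le_max_left _ _) (max_lt one_pos (by linarith)) (by positivity)
    linarith
  · have h2 := Lp_norm_sub_rpow_le hp h f g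
    have h3 := Real.rpow_le_rpow hε.le hfg hr0.le
    rw [hf, hg, Real.one_rpow] at h2
    have h4 : ‖(2 : ℝ)⁻¹ • (f + g)‖ ^ p.toReal ≤ 1 - d := by
      have : d * C = ε ^ p.toReal / 2 := by rw [hd]; field_simp
      by_contra! hlt
      nlinarith
    have h5 : ‖(2 : ℝ)⁻¹ • (f + g)‖ ≤ (max 0 (1 - d)) ^ (p.toReal)⁻¹ := by
      rw [Real.le_rpow_inv_iff_of_pos (norm_nonneg _) (le_max_left _ _) hr0]
      exact h4.trans (le_max_right _ _)
    rw [norm_smul, Real.norm_of_nonneg (by norm_num)] at h5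
    linarith

end LpSpace

/-! ### Chebyshev centres -/

section ChebyshevCentre

theorem affineAction_mul_apply {G E : Type*} [Group G] [NormedAddCommGroup E]
    [NormedSpace ℝ E] (α : G →* (E ≃ᵃⁱ[ℝ] E)) (g h : G) (x : E) :
    α (g * h) x = α g (α h x) := by
  rw [map_mul]; rfl

/-- An isometric affine action on a uniformly convex Banach space with a bounded orbit has a fixed
point. -/
theorem exists_fixedPoint_of_bounded_orbit {G E : Type*} [Group G] [NormedAddCommGroup E]
    [NormedSpace ℝ E] [CompleteSpace E] [UniformConvexSpace E] (α : G →* (E ≃ᵃⁱ[ℝ] E)) (o : E)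
    (C : ℝ) (hC : ∀ g, ‖α g o - o‖ ≤ C) : ∃ x, ∀ g, α g x = x := by
  -- `P z s`: the closed ball of radius `s` about `z` contains the orbit of `o`. The infimum `r` of
  -- such radii is the Chebyshev radius.
  let P : E → ℝ → Prop := fun z s => ∀ g, ‖z - α g o‖ ≤ s
  let A : Set ℝ := {s | ∃ z, P z s}
  have hPinv : ∀ z s g, P z s → P (α g z) s := fun z s g hz h => by
    have h1 := hz (g⁻¹ * h)
    have h2 : α g (α (g⁻¹ * h) o) = α h o := by
      rw [← affineAction_mul_apply, mul_inv_cancel_left]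
    rwa [← h2, ← dist_eq_norm, (α g).dist_map, dist_eq_norm]
  have hne : A.Nonempty := ⟨C, o, fun g => by rw [norm_sub_rev]; exact hC g⟩
  have hbdd : BddBelow A := ⟨0, fun s ⟨z, hz⟩ => (norm_nonneg _).trans (hz 1)⟩
  set r := sInf A with hr
  have hr0 : 0 ≤ r := le_csInf hne fun s ⟨z, hz⟩ => (norm_nonneg _).trans (hz 1)
  have hrle : ∀ z s, P z s → r ≤ s := fun z s h => csInf_le hbdd ⟨z, h⟩
  have key : ∀ ε : ℝ, 0 < ε → ∃ δ : ℝ, 0 < δ ∧ ∀ z w, P z (r + δ) → P w (r + δ) → ‖z - w‖ < ε := by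
    intro ε hε
    rcases hr0.eq_or_lt with h0 | h0
    · refine ⟨ε / 3, by positivity, fun z w hz hw => ?_⟩
      have h1 := hz 1
      have h2 := hw 1
      have h3 : z - w = (z - α 1 o) - (w - α 1 o) := by abel
      rw [h3]
      have := norm_sub_le (z - α 1 o) (w - α 1 o)
      linarith
    · obtain ⟨d, hd, h⟩ := exists_forall_closed_ball_dist_add_le_two_sub E
        (show 0 < ε / (r + 1) by positivity)
      -- If two near-centres were `ε` apart, their midpoint would have radius `s * (1 - d / 2) ≤ r -
      -- r * d / 4 < r`. The bound `1` keeps `s ≤ r + 1`, so the rescaled points are still `ε / (r +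
      -- 1)` apart.
      refine ⟨min 1 (r * d / 4), lt_min one_pos (by positivity), fun z w hz hw => ?_⟩
      by_contra! hlt
      set s := r + min 1 (r * d / 4) with hs
      have hs0 : 0 < s := by
        have : 0 < min 1 (r * d / 4) := lt_min one_pos (by positivity)
        linarith
      have hs1 : s ≤ r + 1 := by rw [hs]; gcongr; exact min_le_left _ _
      have hs2 : s ≤ r + r * d / 4 := by rw [hs]; gcongr; exact min_le_right _ _
      have hn : ∀ x : E, ‖s⁻¹ • x‖ = ‖x‖ / s := fun x => by
        rw [norm_smul, norm_inv, Real.norm_of_nonneg hs0.le, inv_mul_eq_div]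
      have hm : P ((2 : ℝ)⁻¹ • (z + w)) (s * (1 - d / 2)) := fun g => by
        have h1 := @h (s⁻¹ • (z - α g o)) (by rw [hn, div_le_one hs0]; exact hz g)
          (s⁻¹ • (w - α g o)) (by rw [hn, div_le_one hs0]; exact hw g) (by
            rw [← smul_sub, hn, sub_sub_sub_cancel_right]
            gcongr)
        rw [← smul_add, hn, div_le_iff₀ hs0] at h1
        have h2 : (2 : ℝ)⁻¹ • (z + w) - α g o = (2 : ℝ)⁻¹ • ((z - α g o) + (w - α g o)) := by
          module
        rw [h2, norm_smul, Real.norm_of_nonneg (by norm_num)]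
        linarith
      have h3 := hrle _ _ hm
      have h4 : 0 < r * d := by positivity
      have h5 : r * d ≤ s * d := by
        have : r ≤ s := le_add_of_nonneg_right (lt_min one_pos (by positivity)).le
        gcongr
      linarith
  choose δ hδ hkey using key
  have hex : ∀ t : ℝ, 0 < t → ∃ z, P z (r + t) := fun t ht => by
    obtain ⟨s, ⟨z, hz⟩, hs⟩ := exists_lt_of_csInf_lt hne (show sInf A < r + t by linarith)
    exact ⟨z, fun g => (hz g).trans hs.le⟩
  choose! z hz using fun n : ℕ => hex (1 / (n + 1)) Nat.one_div_pos_of_nat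
  have hcau : CauchySeq z := by
    refine Metric.cauchySeq_iff'.2 fun ε hε => ?_
    obtain ⟨N, hN⟩ := exists_nat_one_div_lt (hδ ε hε)
    refine ⟨N, fun n hn => ?_⟩
    rw [dist_eq_norm]
    refine hkey ε hε _ _ (fun g => (hz n g).trans ?_) (fun g => (hz N g).trans ?_)
    · have : (1 : ℝ) / (n + 1) ≤ 1 / (N + 1) := Nat.one_div_le_one_div hn
      linarith
    · linarith
  obtain ⟨x, hx⟩ := cauchySeq_tendsto_of_complete hcau
  have hPx : P x r := fun g => by
    refine le_of_tendsto_of_tendsto' (hx.sub_const (α g o)).norm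
      (show Filter.Tendsto (fun n : ℕ => r + 1 / ((n : ℝ) + 1)) Filter.atTop (𝓝 r) by
        simpa using tendsto_one_div_add_atTop_nhds_zero_nat.const_add r) fun n => hz n g
  refine ⟨x, fun g => ?_⟩
  by_contra hne
  have hpos : 0 < ‖α g x - x‖ := norm_pos_iff.2 (sub_ne_zero.2 hne)
  refine lt_irrefl _ (hkey _ hpos _ _ (fun h => (hPinv x r g hPx h).trans ?_)
    (fun h => (hPx h).trans ?_)) <;> linarith [hδ _ hpos]

end ChebyshevCentre

/-! ### Actions on subspaces of `L^p` for `p ≤ 2` -/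

section LpSubspaces

variable {G : Type u} [Group G] [TopologicalSpace G]
  {X : Type v} [MeasurableSpace X] {μ : Measure X} {p : ℝ≥0∞}

theorem tendsto_rpow_zero {ι : Type*} {l : Filter ι} {f : ι → ℝ} {r : ℝ} (hr : 0 < r)
    (h : Filter.Tendsto f l (𝓝 0)) : Filter.Tendsto (fun i => f i ^ r) l (𝓝 0) := by
  simpa [Real.zero_rpow hr.ne'] using h.rpow_const (p := r) (Or.inr hr.le)

theorem HasPropertyT.hasBoundedLpOrbits [IsTopologicalGroup G] (hT : HasPropertyT.{u, v} G) (hp0 : p ≠ 0) (hp2 : p ≤ 2)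
    (B : Submodule ℝ (Lp ℝ p μ)) : HasBoundedLpOrbits G B := by
  intro α hα x
  have hp : p ≠ ∞ := ne_top_of_le_ne_top ENNReal.ofNat_ne_top hp2
  have hr0 : 0 < p.toReal := ENNReal.toReal_pos hp0 hp
  have hψ := (isCondNegKernel_Lp (μ := μ) hp0 hp2).comap (fun x : B => (x : Lp ℝ p μ))
  have hn : ∀ f : Lp ℝ p μ, 0 ≤ ‖f‖ := fun f => by rw [Lp.norm_def]; exact ENNReal.toReal_nonneg
  let a : G →* Equiv.Perm B := MonoidHom.mk' (fun g => (α g).toEquiv) fun g h => by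
    ext y : 1
    change α (g * h) y = α g (α h y)
    rw [map_mul]; rfl
  obtain ⟨C, hC⟩ := hT.condNegKernel_bounded a hψ (fun g s t => by
      have := hα.isometry g s t
      rw [lpDist, lpDist] at this
      change ‖(α g s : Lp ℝ p μ) - (α g t : Lp ℝ p μ)‖ ^ p.toReal = _
      rw [this]) (fun s => by
      refine tendsto_rpow_zero hr0 (Metric.tendsto_nhds.2 fun ε hε => ?_)
      obtain ⟨U, hU, δ, hδ, h⟩ := hα.continuous 1 s ε hε
      filter_upwards [hU] with g hg
      rw [Real.dist_0_eq_abs, abs_of_nonneg (hn _)]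
      have h1 := h g hg s (by rw [lpDist, sub_self, Lp.norm_zero]; exact hδ)
      rw [map_one] at h1
      exact h1) x
  -- `C` bounds the `p`-th powers of distances to `x`; the quasi-triangle inequality through `x`
  -- replaces the triangle inequality, which fails for `p < 1`.
  refine ⟨(2 * C + 2 * ‖(x : Lp ℝ p μ) - 0‖ ^ p.toReal) ^ (p.toReal)⁻¹, fun g => ?_⟩
  have h1 := hψ.quasi_triangle (a g x) x 0
  have h2 := hC g
  have h3 : lpDist B (α g x) 0 ^ p.toReal ≤ 2 * C + 2 * ‖(x : Lp ℝ p μ) - 0‖ ^ p.toReal := by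
    have h4 : lpDist B (α g x) 0 ^ p.toReal ≤ _ := h1
    refine h4.trans ?_
    rw [Submodule.coe_zero]
    linarith
  exact (Real.le_rpow_inv_iff_of_pos (hn _) ((Real.rpow_nonneg (hn _) _).trans h3) hr0).2 h3

theorem lpDist_eq_dist [Fact (1 ≤ p)] (B : Submodule ℝ (Lp ℝ p μ)) (x y : B) :
    lpDist B x y = dist x y := by
  rw [dist_eq_norm, Submodule.coe_norm, Submodule.coe_sub, lpDist]

/-- The underlying affine action of an affine isometric action. -/
noncomputable def AffineIsometryEquiv.toAffineAction {G E : Type*} [Group G] [NormedAddCommGroup E]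
    [NormedSpace ℝ E] (α : G →* (E ≃ᵃⁱ[ℝ] E)) : G →* (E ≃ᵃ[ℝ] E) :=
  MonoidHom.mk' (fun g => (α g).toAffineEquiv) fun g h => by
    ext y
    exact affineAction_mul_apply α g h y

theorem isLpAffineIsometricAction_of_isometry [Fact (1 ≤ p)] (B : Submodule ℝ (Lp ℝ p μ))
    (α : G →* (B ≃ᵃⁱ[ℝ] B)) (hα : Continuous fun q : G × B => α q.1 q.2) :
    IsLpAffineIsometricAction B (AffineIsometryEquiv.toAffineAction α) := by
  refine ⟨fun g x y => ?_, fun g₀ x₀ ε hε => ?_⟩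
  · rw [lpDist_eq_dist, lpDist_eq_dist]
    exact (α g).dist_map x y
  · have h := Metric.tendsto_nhds.1 (hα.tendsto (g₀, x₀)) ε hε
    rw [nhds_prod_eq, Filter.eventually_prod_iff] at h
    obtain ⟨P, hP, Q, hQ, h⟩ := h
    obtain ⟨δ, hδ, hQ⟩ := Metric.eventually_nhds_iff.1 hQ
    refine ⟨_, hP, δ, hδ, fun g hg x hx => ?_⟩
    rw [lpDist_eq_dist] at hx ⊢
    exact h hg (hQ hx)

theorem HasPropertyT.hasPropertyFB_of_le_two [IsTopologicalGroup G]
    (hT : HasPropertyT.{u, v} G) [Fact (1 ≤ p)]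
    (hp1 : 1 < p) (hp2 : p ≤ 2) (B : Submodule ℝ (Lp ℝ p μ))
    (hB : IsClosed (B : Set (Lp ℝ p μ))) : HasPropertyFB G B := by
  intro α hα
  have hp : p ≠ ∞ := ne_top_of_le_ne_top ENNReal.ofNat_ne_top hp2
  have : CompleteSpace B := hB.completeSpace_coe
  have : UniformConvexSpace B := by
    have := Lp_uniformConvexSpace (μ := μ) hp1 hp
    refine ⟨fun ε hε => ?_⟩
    obtain ⟨δ, hδ, h⟩ := UniformConvexSpace.uniform_convex (E := Lp ℝ p μ) hε
    exact ⟨δ, hδ, fun x hx y hy hxy => h hx hy hxy⟩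
  obtain ⟨C, hC⟩ := hT.hasBoundedLpOrbits (zero_lt_one.trans hp1).ne' hp2 B _
    (isLpAffineIsometricAction_of_isometry B α hα) 0
  refine exists_fixedPoint_of_bounded_orbit α 0 C fun g => ?_
  have h := hC g
  rwa [lpDist_eq_dist, dist_eq_norm] at h

end LpSubspaces

/-! ### Compact generation -/

section CompactGeneration

theorem isPosKernel_eq {S : Type*} [DecidableEq S] :
    IsPosKernel fun s t : S => if s = t then (1 : ℝ) else 0 := by
  refine ⟨fun s t => by simp [eq_comm], fun c => ?_⟩
  refine Finset.sum_nonneg fun i hi => ?_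
  simp only [mul_ite, mul_one, mul_zero, Finset.sum_ite_eq, hi, if_true]
  exact mul_self_nonneg _

theorem Subgroup.countable_quotient_of_isOpen {G : Type*} [Group G] [TopologicalSpace G]
    [IsTopologicalGroup G] [SecondCountableTopology G] {H : Subgroup G} (hH : IsOpen (H : Set G)) :
    Countable (G ⧸ H) := by
  obtain ⟨D, hDc, hD⟩ := TopologicalSpace.exists_countable_dense G
  have := hDc.to_subtype
  refine Function.Surjective.countable (f := fun d : D => (QuotientGroup.mk (d : G) : G ⧸ H)) ?_
  intro x
  obtain ⟨g, rfl⟩ := QuotientGroup.mk_surjective x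
  have ho : IsOpen ((fun y => g⁻¹ * y) ⁻¹' (H : Set G)) := hH.preimage (by fun_prop)
  obtain ⟨d, hd1, hd2⟩ := hD.exists_mem_open ho ⟨g, by simp [H.one_mem]⟩
  exact ⟨⟨d, hd1⟩, (QuotientGroup.eq.2 hd2).symm⟩

/-- A group with property (T) is compactly generated. -/
theorem HasPropertyT.exists_compact_generating {G : Type u} [Group G] [TopologicalSpace G]
    [IsTopologicalGroup G] [LocallyCompactSpace G] [SecondCountableTopology G]
    (hT : HasPropertyT.{u, v} G) :
    ∃ K : Set G, IsCompact K ∧ K ∈ 𝓝 1 ∧ Subgroup.closure K = ⊤ := by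
  classical
  obtain ⟨K, hK, C, hC, h⟩ := hT.posKernel_bound
  obtain ⟨V, hV, hV1⟩ := exists_compact_mem_nhds (1 : G)
  refine ⟨K ∪ V, hK.union hV, Filter.mem_of_superset hV1 Set.subset_union_right, ?_⟩
  -- `H` is open, so the delta kernel on `G ⧸ H` is continuous along orbits. `K` fixes the base
  -- coset, and the kernel bound with `m = 0` forces `G` to fix it.
  set H := Subgroup.closure (K ∪ V)
  have hsub : K ∪ V ⊆ H := Subgroup.subset_closure
  have hHo : IsOpen (H : Set G) := Subgroup.isOpen_of_mem_nhds (g := 1) H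
    (Filter.mem_of_superset hV1 (Set.subset_union_right.trans hsub))
  have := Subgroup.countable_quotient_of_isOpen hHo
  -- Property (T) is tested only on spaces in universe `v`; countability allows a copy of `G ⧸ H`
  -- there.
  have : Small.{v} (G ⧸ H) := Countable.toSmall _
  let e := equivShrink.{v} (G ⧸ H)
  let a : G →* Equiv.Perm (Shrink.{v} (G ⧸ H)) :=
    e.permCongrHom.toMonoidHom.comp (MulAction.toPermHom G (G ⧸ H))
  have ha : ∀ (g : G) (x : G ⧸ H), a g (e x) = e (g • x) := fun g x => by
    simp [a]
  have key := h _ a _ isPosKernel_eq (fun g s t => by simp) (fun s => by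
    obtain ⟨x, rfl⟩ := e.surjective s
    obtain ⟨y, rfl⟩ := QuotientGroup.mk_surjective x
    refine tendsto_const_nhds.congr' ?_
    have hc : Continuous fun g : G => y⁻¹ * (g⁻¹ * y) := by fun_prop
    have hm : (fun g : G => y⁻¹ * (g⁻¹ * y)) ⁻¹' (H : Set G) ∈ 𝓝 1 :=
      (hHo.preimage hc).mem_nhds (by simp [H.one_mem])
    filter_upwards [hm] with g hg
    have : g • (QuotientGroup.mk y : G ⧸ H) = QuotientGroup.mk y := by
      change (QuotientGroup.mk (g * y) : G ⧸ H) = QuotientGroup.mk y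
      rw [QuotientGroup.eq]
      simpa [mul_assoc] using hg
    rw [ha, this]) (e (QuotientGroup.mk 1)) 0 le_rfl (fun g hg => by
      have : g • (QuotientGroup.mk 1 : G ⧸ H) = QuotientGroup.mk 1 := by
        change (QuotientGroup.mk (g * 1) : G ⧸ H) = QuotientGroup.mk 1
        rw [QuotientGroup.eq]
        simpa using hsub (Or.inl hg)
      rw [ha, this]; simp)
  refine eq_top_iff.2 fun g _ => ?_
  have h1 := key g
  rw [ha] at h1
  by_contra hg
  have : g • (QuotientGroup.mk 1 : G ⧸ H) ≠ QuotientGroup.mk 1 := by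
    change (QuotientGroup.mk (g * 1) : G ⧸ H) ≠ QuotientGroup.mk 1
    rw [Ne, QuotientGroup.eq]
    simpa using hg
  rw [if_pos rfl, if_neg fun h => this (e.injective h), mul_zero] at h1
  linarith

end CompactGeneration

/-! ### Smoothing points by averaging over the group -/

section Smoothing

open scoped Pointwise

/-- Averaging an affine isometric action against a continuous density near the identity produces
points whose orbit maps have a modulus of continuity depending only on the group. -/
theorem exists_smoothing {G : Type u} [Group G] [TopologicalSpace G] [IsTopologicalGroup G]
    [LocallyCompactSpace G] [SecondCountableTopology G] {K : Set G} (hK : IsCompact K)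
    (hK1 : K ∈ 𝓝 1) : ∃ N : G → ℝ, Filter.Tendsto N (𝓝 1) (𝓝 0) ∧
      ∀ (E : Type w) [NormedAddCommGroup E] [NormedSpace ℝ E] [CompleteSpace E]
        (α : G →* (E ≃ᵃⁱ[ℝ] E)), (∀ x, Continuous fun g => α g x) → ∀ (x : E) (r : ℝ),
        (∀ g ∈ K, ‖α g x - x‖ ≤ r) →
          ∃ y, ‖y - x‖ ≤ r ∧ ∀ h ∈ K, ‖α h y - y‖ ≤ r * N h := by
  let _ : MeasurableSpace G := borel G
  have : BorelSpace G := ⟨rfl⟩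
  let μ : Measure G := Measure.haar
  obtain ⟨f₀, hf1, hfc, hfs, hf01⟩ := exists_continuousMap_one_of_isCompact_subset_isOpen
    (isCompact_singleton (x := (1 : G))) isOpen_interior
    (Set.singleton_subset_iff.2 (mem_interior_iff_mem_nhds.2 hK1))
  have hf₀pos : 0 < ∫ g, f₀ g ∂μ := f₀.continuous.integral_pos_of_hasCompactSupport_nonneg_nonzero
    hfc (fun g => (hf01 g).1) (x := 1) (by rw [hf1 rfl]; exact one_ne_zero)
  let f : G → ℝ := fun g => f₀ g / ∫ g, f₀ g ∂μ
  have hfcont : Continuous f := f₀.continuous.div_const _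
  have hf0 : ∀ g, 0 ≤ f g := fun g => div_nonneg (hf01 g).1 hf₀pos.le
  have hfK : ∀ g, g ∉ K → f g = 0 := fun g hg => by
    have : f₀ g = 0 := by
      by_contra h
      exact hg (interior_subset (hfs (subset_tsupport _ h)))
    simp [f, this]
  have hfcs : HasCompactSupport f :=
    HasCompactSupport.comp_left (g := fun t => t / ∫ g, f₀ g ∂μ) hfc (zero_div _)
  have hfint : ∫ g, f g ∂μ = 1 := by
    simp only [f]
    rw [integral_div, div_self hf₀pos.ne']
  let Q : Set G := K ∪ K * K
  have hQ : IsCompact Q := hK.union (hK.mul hK)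
  -- For `h ∈ K`, `Q` contains the support of `f` and of its translate by `h`, and on `Q` the point
  -- `x` moves by at most `2 * r`; this is the factor `2`.
  let N : G → ℝ := fun h => 2 * ∫ g in Q, |f (h⁻¹ * g) - f g| ∂μ
  have hNc : Continuous N := by
    refine continuous_const.mul ?_
    refine continuous_parametric_integral_of_continuous (f := fun h g => |f (h⁻¹ * g) - f g|) ?_ hQ
    have h1 : Continuous fun q : G × G => q.1⁻¹ * q.2 := by fun_prop
    exact ((hfcont.comp h1).sub (hfcont.comp continuous_snd)).abs
  have hN1 : N 1 = 0 := by simp [N]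
  refine ⟨N, by simpa [hN1] using hNc.tendsto 1, ?_⟩
  intro E _ _ _ α hα x r hr
  have hr0 : 0 ≤ r := (norm_nonneg _).trans (hr 1 (mem_of_mem_nhds hK1))
  let F : G → E := fun g => α g x - x
  have hFc : Continuous F := (hα x).sub continuous_const
  have hcs : ∀ h, HasCompactSupport fun g => f (h⁻¹ * g) := fun h =>
    hfcs.comp_homeomorph (Homeomorph.mulLeft h⁻¹)
  have hc : ∀ h, Continuous fun g => f (h⁻¹ * g) := fun h => by
    have h1 : Continuous fun g : G => h⁻¹ * g := by fun_prop
    exact hfcont.comp h1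
  have hint : ∀ h, Integrable (fun g => f (h⁻¹ * g) • F g) μ := fun h =>
    ((hc h).smul hFc).integrable_of_hasCompactSupport (hcs h).smul_right
  have hint1 : Integrable (fun g => f g • F g) μ := by simpa using hint 1
  refine ⟨x + ∫ g, f g • F g ∂μ, ?_, fun h hh => ?_⟩
  · rw [add_sub_cancel_left]
    have h1 : ∀ g, ‖f g • F g‖ ≤ r * f g := fun g => by
      rw [norm_smul, Real.norm_of_nonneg (hf0 g), mul_comm]
      by_cases hg : g ∈ K
      · exact mul_le_mul_of_nonneg_right (hr g hg) (hf0 g)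
      · rw [hfK g hg]; simp
    have hfi : Integrable f μ := hfcont.integrable_of_hasCompactSupport hfcs
    have h2 := norm_integral_le_of_norm_le (hfi.const_mul r) (Filter.Eventually.of_forall h1)
    rwa [integral_const_mul, hfint, mul_one] at h2
  -- By left invariance of Haar measure, moving the average by `h` only translates the density; the
  -- terms `F h` cancel because `f` has integral `1`.
  · have hmap : α h (x + ∫ g, f g • F g ∂μ) = x + ∫ g, f (h⁻¹ * g) • F g ∂μ := by
      have h1 : α h (x + ∫ g, f g • F g ∂μ) = α h x +
          (α h).linearIsometryEquiv (∫ g, f g • F g ∂μ) := by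
        have := (α h).map_vadd x (∫ g, f g • F g ∂μ)
        rw [vadd_eq_add, vadd_eq_add, add_comm] at this
        rw [this, add_comm]
      have h2 : (α h).linearIsometryEquiv (∫ g, f g • F g ∂μ) =
          ∫ g, f g • (α h).linearIsometryEquiv (F g) ∂μ := by
        rw [← LinearIsometryEquiv.coe_toContinuousLinearEquiv,
          ← ContinuousLinearEquiv.coe_coe, ← ContinuousLinearMap.integral_comp_comm _ hint1]
        simp only [map_smul]
      have h3 : ∀ g, (α h).linearIsometryEquiv (F g) = F (h * g) - F h := fun g => by
        have := (α h).map_vsub (α g x) x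
        simp only [vsub_eq_sub] at this
        simp only [F]
        rw [this, affineAction_mul_apply]
        abel
      have h4 : ∫ g, f g • (F (h * g) - F h) ∂μ = ∫ g, f (h⁻¹ * g) • (F g - F h) ∂μ := by
        rw [← integral_mul_left_eq_self (fun g => f (h⁻¹ * g) • (F g - F h)) h]
        simp
      have h5 : ∫ g, f (h⁻¹ * g) • (F g - F h) ∂μ = (∫ g, f (h⁻¹ * g) • F g ∂μ) - F h := by
        have h6 : Integrable (fun g => f (h⁻¹ * g)) μ := (hc h).integrable_of_hasCompactSupport (hcs h)
        simp only [smul_sub]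
        rw [integral_sub (hint h) (h6.smul_const _), integral_smul_const,
          integral_mul_left_eq_self f h⁻¹, hfint, one_smul]
      rw [h1, h2]
      simp only [h3]
      rw [h4, h5]
      simp only [F]
      abel
    rw [hmap, add_sub_add_left_eq_sub, ← integral_sub (hint h) hint1]
    have hzero : ∀ g, g ∉ Q → f (h⁻¹ * g) - f g = 0 := fun g hg => by
      rw [hfK g fun h' => hg (Or.inl h'), hfK (h⁻¹ * g) fun h' => hg (Or.inr ?_), sub_zero]
      exact ⟨h, hh, h⁻¹ * g, h', by simp⟩
    have hbd : ∀ g, ‖f (h⁻¹ * g) • F g - f g • F g‖ ≤ 2 * r * |f (h⁻¹ * g) - f g| := fun g => by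
      rw [← sub_smul, norm_smul, Real.norm_eq_abs, mul_comm]
      by_cases hg : g ∈ Q
      · refine mul_le_mul_of_nonneg_right ?_ (abs_nonneg _)
        rcases hg with hg | ⟨a, ha, b, hb, rfl⟩
        · exact (hr g hg).trans (by linarith)
        · have h1 : F (a * b) = (α a (α b x) - α a x) + (α a x - x) := by
            simp only [F, affineAction_mul_apply]; abel
          change ‖F (a * b)‖ ≤ _
          rw [h1]
          refine (norm_add_le _ _).trans ?_
          rw [← dist_eq_norm, (α a).dist_map, dist_eq_norm]
          linarith [hr a ha, hr b hb]
      · rw [hzero g hg]; simp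
    have hI : Integrable (fun g => |f (h⁻¹ * g) - f g|) μ :=
      (((hc h).integrable_of_hasCompactSupport (hcs h)).sub
        (hfcont.integrable_of_hasCompactSupport hfcs)).abs
    have h2 := norm_integral_le_of_norm_le (hI.const_mul (2 * r)) (Filter.Eventually.of_forall hbd)
    rw [integral_const_mul] at h2
    have h3 : ∫ g in Q, |f (h⁻¹ * g) - f g| ∂μ = ∫ g, |f (h⁻¹ * g) - f g| ∂μ :=
      setIntegral_eq_integral_of_forall_compl_eq_zero fun g hg => by rw [hzero g hg, abs_zero]
    have h4 : r * N h = 2 * r * ∫ g, |f (h⁻¹ * g) - f g| ∂μ := by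
      simp only [N]; rw [h3]; ring
    rw [h4]; exact h2

end Smoothing

/-! ### Ultralimits of actions on nearly Hilbertian spaces -/

section Limit

theorem rpow_le_max_one_rpow {t m r : ℝ} (ht : 0 ≤ t) (htm : t ≤ m) (hr2 : 2 ≤ r) (hr3 : r ≤ 3) :
    t ^ r ≤ max 1 m ^ (3 : ℝ) :=
  (Real.rpow_le_rpow ht (htm.trans (le_max_right _ _)) (by linarith)).trans
    (Real.rpow_le_rpow_of_exponent_le (le_max_left _ _) hr3)

open Filter in
/-- Consider affine isometric actions on spaces `E n` whose norms become Hilbertian as `n → ∞`, with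
points `x n` having orbits that are bounded and equicontinuous at scale `d n`. Under property (T),
for infinitely many `n` there is a point of displacement at most `d n / 2` at distance `O (d n)` of
`x n`. -/
theorem HasPropertyT.exists_small_displacement_of_limit {G : Type u} [Group G] [TopologicalSpace G]
    [IsTopologicalGroup G] (hT : HasPropertyT.{u, v} G) {K : Set G} (hK : IsCompact K)
    (E : ℕ → Type v) [∀ n, NormedAddCommGroup (E n)] [∀ n, NormedSpace ℝ (E n)] (r : ℕ → ℝ)
    (hr2 : ∀ n, 2 ≤ r n) (hr3 : ∀ n, r n ≤ 3)
    (hcn : ∀ (S : Type v) (c : S →₀ ℝ), ∑ i ∈ c.support, c i = 0 → ∀ η : ℝ, 0 < η →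
      ∀ᶠ n in atTop, ∀ F : S → E n, kernelForm (fun i j => ‖F i - F j‖ ^ r n) c ≤
        η * ∑ i ∈ c.support, ‖F i‖ ^ r n)
    (hcl : ∀ n (x y u : E n), ‖midpoint ℝ x y - u‖ ^ r n + ‖x - y‖ ^ r n / 8 ≤
      (‖x - u‖ ^ r n + ‖y - u‖ ^ r n) / 2)
    (α : ∀ n, G →* (E n ≃ᵃⁱ[ℝ] E n)) (x : ∀ n, E n) (d : ℕ → ℝ) (hd : ∀ n, 0 < d n)
    (hbd : ∀ g, ∃ C : ℝ, ∀ n, ‖α n g (x n) - x n‖ ≤ C * d n)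
    (hc : ∀ ε : ℝ, 0 < ε → ∀ᶠ h in 𝓝 (1 : G), ∀ n, ‖α n h (x n) - x n‖ ≤ ε * d n) :
    ∃ R : ℝ, ∃ᶠ n in atTop, ∃ z, ‖z - x n‖ ≤ R * d n ∧ ∀ g ∈ K, ‖α n g z - z‖ ≤ d n / 2 := by
  have hiso : ∀ n g (y z : E n), ‖α n g y - α n g z‖ = ‖y - z‖ := fun n g y z => by
    rw [← dist_eq_norm, (α n g).dist_map, dist_eq_norm]
  -- Sequences bounded and equicontinuous at scale `d n`. They are stable under the action and under
  -- midpoints, all that the centre argument needs.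
  let P : (∀ n, E n) → Prop := fun z => (∃ C : ℝ, ∀ n, ‖z n - x n‖ ≤ C * d n) ∧
    ∀ ε : ℝ, 0 < ε → ∀ᶠ h in 𝓝 (1 : G), ∀ n, ‖α n h (z n) - z n‖ ≤ ε * d n
  let S : Type v := {z : ∀ n, E n // P z}
  have hPα : ∀ z, P z → ∀ g, P fun n => α n g (z n) := by
    rintro z ⟨⟨C, hC⟩, hz⟩ g
    obtain ⟨C', hC'⟩ := hbd g
    refine ⟨⟨C + C', fun n => ?_⟩, fun ε hε => ?_⟩
    · have h1 : α n g (z n) - x n = (α n g (z n) - α n g (x n)) + (α n g (x n) - x n) := by abel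
      rw [h1]
      refine (norm_add_le _ _).trans ?_
      rw [hiso]
      linarith [hC n, hC' n]
    · have h1 : Tendsto (fun h => g⁻¹ * h * g) (𝓝 1) (𝓝 1) := by
        have : Continuous fun h : G => g⁻¹ * h * g := by fun_prop
        simpa using this.tendsto 1
      filter_upwards [h1.eventually (hz ε hε)] with h hh n
      have h2 := hh n
      rw [← hiso n g, ← affineAction_mul_apply, mul_assoc, mul_inv_cancel_left,
        affineAction_mul_apply] at h2
      exact h2
  have hPm : ∀ z w, P z → P w → P fun n => midpoint ℝ (z n) (w n) := by
    rintro z w ⟨⟨C, hC⟩, hz⟩ ⟨⟨C', hC'⟩, hw⟩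
    have hmid : ∀ n (a b a' b' : E n) (t : ℝ), ‖a - a'‖ ≤ t → ‖b - b'‖ ≤ t →
        ‖midpoint ℝ a b - midpoint ℝ a' b'‖ ≤ t := fun n a b a' b' t h1 h2 => by
      have h3 := dist_midpoint_midpoint_le (V := E n) a b a' b'
      rw [dist_eq_norm, dist_eq_norm, dist_eq_norm] at h3
      linarith
    refine ⟨⟨max C C', fun n => ?_⟩, fun ε hε => ?_⟩
    · have h1 := hmid n (z n) (w n) (x n) (x n) (max C C' * d n)
        ((hC n).trans (mul_le_mul_of_nonneg_right (le_max_left _ _) (hd n).le))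
        ((hC' n).trans (mul_le_mul_of_nonneg_right (le_max_right _ _) (hd n).le))
      rwa [midpoint_self] at h1
    · filter_upwards [hz ε hε, hw ε hε] with h h1 h2 n
      rw [show α n h (midpoint ℝ (z n) (w n)) = midpoint ℝ (α n h (z n)) (α n h (w n)) from
        (α n h).toAffineEquiv.map_midpoint (z n) (w n)]
      exact hmid n _ _ _ _ _ (h1 n) (h2 n)
  let a : G →* Equiv.Perm S := MonoidHom.mk' (fun g =>
    { toFun := fun z => ⟨fun n => α n g (z.1 n), hPα z.1 z.2 g⟩
      invFun := fun z => ⟨fun n => α n g⁻¹ (z.1 n), hPα z.1 z.2 g⁻¹⟩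
      left_inv := fun z => Subtype.ext <| funext fun n => by
        change α n g⁻¹ (α n g (z.1 n)) = z.1 n
        rw [← affineAction_mul_apply, inv_mul_cancel, map_one]; rfl
      right_inv := fun z => Subtype.ext <| funext fun n => by
        change α n g (α n g⁻¹ (z.1 n)) = z.1 n
        rw [← affineAction_mul_apply, mul_inv_cancel, map_one]; rfl }) fun g h =>
      Equiv.ext fun z => Subtype.ext <| funext fun n => affineAction_mul_apply (α n) g h (z.1 n)
  have haapp : ∀ g (z : S) n, (a g z).1 n = α n g (z.1 n) := fun _ _ _ => rfl
  let U : Ultrafilter ℕ := hyperfilter ℕ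
  have hU : (U : Filter ℕ) ≤ atTop := Nat.hyperfilter_le_atTop
  let k : ℕ → S → S → ℝ := fun n z w => (‖z.1 n - w.1 n‖ / d n) ^ r n
  have hk0 : ∀ (n : ℕ) (z w : S), 0 ≤ ‖z.1 n - w.1 n‖ / d n := fun n z w => div_nonneg (norm_nonneg _) (hd n).le
  have hex : ∀ z w, ∃ l, Tendsto (fun n => k n z w) U (𝓝 l) := by
    rintro ⟨z, ⟨C, hC⟩, hz⟩ ⟨w, ⟨C', hC'⟩, hw⟩
    obtain ⟨l, -, hl⟩ := (isCompact_Icc (a := (0 : ℝ)) (b := max 1 (C + C') ^ (3 : ℝ))).ultrafilter_le_nhds'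
      (U.map fun n => k n ⟨z, ⟨C, hC⟩, hz⟩ ⟨w, ⟨C', hC'⟩, hw⟩) (by
        refine Filter.mem_map.2 (Filter.univ_mem' fun n => ⟨Real.rpow_nonneg (hk0 _ _ _) _, ?_⟩)
        refine rpow_le_max_one_rpow (hk0 _ _ _) ?_ (hr2 n) (hr3 n)
        rw [div_le_iff₀ (hd n)]
        have h1 : z n - w n = (z n - x n) - (w n - x n) := by abel
        have h2 := norm_sub_le (z n - x n) (w n - x n)
        change ‖z n - w n‖ ≤ _
        rw [h1]
        linarith [hC n, hC' n])
    exact ⟨l, hl⟩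
  choose ψ hψ using hex
  have hψcn : IsCondNegKernel ψ := by
    refine ⟨fun z w => ?_, fun z => ?_, fun c hcs => ?_⟩
    · refine tendsto_nhds_unique (hψ z w) ((hψ w z).congr fun n => ?_)
      simp only [k, norm_sub_rev]
    · refine tendsto_nhds_unique (hψ z z) (tendsto_const_nhds.congr fun n => ?_)
      simp only [k, sub_self, norm_zero, zero_div]
      rw [Real.zero_rpow (by linarith [hr2 n])]
    · have hlim := tendsto_kernelForm hψ c
      -- `M z` bounds the rescaled `r n`-th powers uniformly in `n`, so the error allowed by `hcn`
      -- is at most `η` for every `η > 0`.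
      let M : S → ℝ := fun z => max 1 z.2.1.choose ^ (3 : ℝ)
      have hM : ∀ (z : S) n, ‖(d n)⁻¹ • (z.1 n - x n)‖ ^ r n ≤ M z := fun z n => by
        refine rpow_le_max_one_rpow (norm_nonneg _) ?_ (hr2 n) (hr3 n)
        rw [norm_smul, norm_inv, Real.norm_of_nonneg (hd n).le, inv_mul_le_iff₀ (hd n), mul_comm]
        exact z.2.1.choose_spec n
      have hM0 : ∀ z, 0 ≤ M z := fun z => Real.rpow_nonneg (zero_le_one.trans (le_max_left _ _)) _
      have hsum0 : 0 ≤ ∑ i ∈ c.support, M i := Finset.sum_nonneg fun i _ => hM0 i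
      refine le_of_forall_pos_le_add fun η hη => ?_
      rw [zero_add]
      refine le_of_tendsto hlim ?_
      have hη' : 0 < η / (∑ i ∈ c.support, M i + 1) := by positivity
      filter_upwards [hU (hcn S c hcs _ hη')] with n hn
      have h1 := hn fun z => (d n)⁻¹ • (z.1 n - x n)
      have h2 : kernelForm (k n) c = kernelForm (fun i j : S =>
          ‖(d n)⁻¹ • (i.1 n - x n) - (d n)⁻¹ • (j.1 n - x n)‖ ^ r n) c := by
        congr 1
        funext i j
        rw [← smul_sub, sub_sub_sub_cancel_right, norm_smul, norm_inv,
          Real.norm_of_nonneg (hd n).le, inv_mul_eq_div]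
      change kernelForm (k n) c ≤ η
      rw [h2]
      refine h1.trans ?_
      rw [div_mul_eq_mul_div, div_le_iff₀ (by positivity)]
      have h3 := Finset.sum_le_sum fun i (_ : i ∈ c.support) => hM i n
      exact mul_le_mul_of_nonneg_left (by linarith) hη.le
  have hinv : ∀ g z w, ψ (a g z) (a g w) = ψ z w := fun g z w => by
    refine tendsto_nhds_unique (hψ _ _) ((hψ z w).congr fun n => ?_)
    simp only [k, haapp, hiso]
  have hcont : ∀ z, Tendsto (fun g => ψ (a g z) z) (𝓝 1) (𝓝 0) := fun z => by
    refine Metric.tendsto_nhds.2 fun ε hε => ?_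
    -- A rescaled displacement at most `1` does not grow when raised to the power `r n ≥ 1`.
    have hε' : 0 < min (ε / 2) 1 := lt_min (by positivity) one_pos
    filter_upwards [z.2.2 _ hε'] with g hg
    rw [Real.dist_0_eq_abs, abs_of_nonneg (hψcn.nonneg _ _)]
    refine lt_of_le_of_lt (le_of_tendsto' (hψ _ _) fun n => ?_) (half_lt_self hε)
    have h1 : ‖(a g z).1 n - z.1 n‖ / d n ≤ min (ε / 2) 1 := by
      rw [div_le_iff₀ (hd n)]; exact hg n
    calc k n (a g z) z ≤ (‖(a g z).1 n - z.1 n‖ / d n) ^ (1 : ℝ) :=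
          Real.rpow_le_rpow_of_exponent_ge_of_imp (hk0 _ _ _) (h1.trans (min_le_right _ _))
            (by linarith [hr2 n]) (fun _ h => by linarith [hr2 n])
      _ ≤ ε / 2 := by rw [Real.rpow_one]; exact h1.trans (min_le_left _ _)
  let o : S := ⟨x, ⟨0, fun n => by simp⟩, hc⟩
  obtain ⟨C, hC⟩ := hT.condNegKernel_bounded a hψcn hinv hcont o
  let A : Set ℝ := {s | ∃ z, ∀ g, ψ z (a g o) ≤ s}
  have hne : A.Nonempty := ⟨C, o, fun g => by rw [hψcn.symm]; exact hC g⟩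
  have hAb : BddBelow A := ⟨0, fun s ⟨z, hz⟩ => (hψcn.nonneg _ _).trans (hz 1)⟩
  -- A near-centre suffices, so no completeness of the limit is needed. Comparing `sInf A` with the
  -- midpoint of `a g z` and `z` gives `ψ (a g z) z / 8 < 1 / 1024`.
  obtain ⟨s, ⟨z, hz⟩, hs⟩ := exists_lt_of_csInf_lt hne
    (show sInf A < sInf A + 1 / 1024 by norm_num)
  have hnear : ∀ g, ψ (a g z) z ≤ 1 / 128 := fun g => by
    let m : S := ⟨fun n => midpoint ℝ ((a g z).1 n) (z.1 n), hPm _ _ (a g z).2 z.2⟩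
    have h1 : ∀ h, ψ m (a h o) ≤ s - ψ (a g z) z / 8 := fun h => by
      have h2 : ψ m (a h o) + ψ (a g z) z / 8 ≤ (ψ (a g z) (a h o) + ψ z (a h o)) / 2 := by
        refine le_of_tendsto_of_tendsto' ((hψ m (a h o)).add ((hψ (a g z) z).div_const 8))
          (((hψ (a g z) (a h o)).add (hψ z (a h o))).div_const 2) fun n => ?_
        have h3 := hcl n ((a g z).1 n) (z.1 n) ((a h o).1 n)
        simp only [k, Real.div_rpow (norm_nonneg _) (hd n).le]
        have h4 := div_le_div_of_nonneg_right h3 (Real.rpow_nonneg (hd n).le (r n))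
        refine le_trans (le_of_eq ?_) (h4.trans (le_of_eq ?_))
        · simp only [m]; ring
        · ring
      have h5 : ψ (a g z) (a h o) ≤ s := by
        have h6 := hz (g⁻¹ * h)
        rw [← hinv g, ← Equiv.Perm.mul_apply, ← map_mul, mul_inv_cancel_left] at h6
        exact h6
      linarith [hz h]
    have h7 : sInf A ≤ s - ψ (a g z) z / 8 := csInf_le hAb ⟨m, h1⟩
    linarith
  obtain ⟨R, hR⟩ := z.2.1
  refine ⟨R, ?_⟩
  have hfin : ∀ᶠ n in (U : Filter ℕ), ∀ g ∈ K, ‖α n g (z.1 n) - z.1 n‖ ≤ d n / 2 := by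
    refine hK.induction_on (p := fun T => ∀ᶠ n in (U : Filter ℕ), ∀ g ∈ T,
      ‖α n g (z.1 n) - z.1 n‖ ≤ d n / 2) (by simp)
      (fun T T' hTT h => h.mono fun n hn g hg => hn g (hTT hg)) (fun T T' h h' => ?_)
      fun g₀ _ => ?_
    · filter_upwards [h, h'] with n hn hn' g hg
      exact hg.elim (hn g) (hn' g)
    -- Since `(1 / 4) ^ r n ≥ 1 / 64 > 1 / 128`, the displacement by `g₀` is eventually at most `d n
    -- / 4`; equicontinuity adds at most `d n / 4` near `g₀`, and compactness of `K` concludes.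
    · have h1 : Tendsto (fun g => g₀⁻¹ * g) (𝓝 g₀) (𝓝 1) := by
        have : Continuous fun g : G => g₀⁻¹ * g := by fun_prop
        simpa using this.tendsto g₀
      have h2 := h1.eventually (z.2.2 (1 / 4) (by norm_num))
      refine ⟨_, mem_nhdsWithin_of_mem_nhds h2, ?_⟩
      have h3 := (hψ (a g₀ z) z).eventually
        (gt_mem_nhds ((hnear g₀).trans_lt (show (1 / 128 : ℝ) < 1 / 64 by norm_num)))
      filter_upwards [h3] with n hn g hg
      have h4 : ‖α n g₀ (z.1 n) - z.1 n‖ ≤ d n / 4 := by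
        by_contra! hlt
        have h5 : (1 / 4 : ℝ) ≤ ‖(a g₀ z).1 n - z.1 n‖ / d n := by
          rw [le_div_iff₀ (hd n)]
          have := hlt.le
          rw [haapp]
          linarith
        have h6 := Real.rpow_le_rpow (by norm_num) h5 (by linarith [hr2 n] : 0 ≤ r n)
        have h7 : (1 / 4 : ℝ) ^ (3 : ℝ) ≤ (1 / 4) ^ r n :=
          Real.rpow_le_rpow_of_exponent_ge (by norm_num) (by norm_num) (hr3 n)
        norm_num at h7
        have h8 : k n (a g₀ z) z < 1 / 64 := hn
        have h9 : (1 / 4 : ℝ) ^ r n ≤ k n (a g₀ z) z := h6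
        norm_num at h9 h8
        linarith
      have h5 : ‖α n (g₀⁻¹ * g) (z.1 n) - z.1 n‖ ≤ 1 / 4 * d n := hg n
      rw [← hiso n g₀, ← affineAction_mul_apply, mul_inv_cancel_left] at h5
      have h6 : α n g (z.1 n) - z.1 n =
        (α n g (z.1 n) - α n g₀ (z.1 n)) + (α n g₀ (z.1 n) - z.1 n) := by abel
      rw [h6]
      refine (norm_add_le _ _).trans ?_
      linarith
  have hfreq : ∃ᶠ n in (U : Filter ℕ), ∃ z, ‖z - x n‖ ≤ R * d n ∧
      ∀ g ∈ K, ‖α n g z - z‖ ≤ d n / 2 :=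
    (hfin.mono fun n hn => ⟨z.1 n, hR n, hn⟩).frequently
  exact hfreq.filter_mono hU

end Limit

/-! ### Halving displacements, and fixed points for `p` near `2` -/

section NearHilbert

/-- The properties of the norm of a closed subspace of `L^r`, `2 ≤ r ≤ 3`, which make it close to a
Hilbert norm when `r` is close to `2`. -/
structure IsNearHilbert (E : Type v) [NormedAddCommGroup E] [NormedSpace ℝ E] (r : ℝ) : Prop where
  complete : CompleteSpace E
  two_le : 2 ≤ r
  le_three : r ≤ 3
  clarkson : ∀ x y u : E, ‖midpoint ℝ x y - u‖ ^ r + ‖x - y‖ ^ r / 8 ≤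
    (‖x - u‖ ^ r + ‖y - u‖ ^ r) / 2
  kernelForm_le : ∀ (S : Type v) (c : S →₀ ℝ) (η δ : ℝ), (∀ p : ℝ, 2 ≤ p → p < 2 + δ →
    ∀ f : S → ℝ, kernelForm (fun i j => |f i - f j| ^ p) c ≤ η * ∑ i ∈ c.support, |f i| ^ p) →
    r < 2 + δ → ∀ F : S → E, kernelForm (fun i j => ‖F i - F j‖ ^ r) c ≤
      η * ∑ i ∈ c.support, ‖F i‖ ^ r

theorem isNearHilbert_Lp {X : Type v} [MeasurableSpace X] {μ : Measure X} {p : ℝ≥0∞}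
    [Fact (1 ≤ p)] (h2 : 2 ≤ p) (h3 : p ≤ 3) (B : Submodule ℝ (Lp ℝ p μ))
    (hB : IsClosed (B : Set (Lp ℝ p μ))) : IsNearHilbert B p.toReal := by
  have hp : p ≠ ∞ := ne_top_of_le_ne_top ENNReal.ofNat_ne_top h3
  refine ⟨hB.completeSpace_coe, by simpa using ENNReal.toReal_mono hp h2,
    by simpa using ENNReal.toReal_mono ENNReal.ofNat_ne_top h3, fun x y u => ?_,
    fun S c η δ h hδ F => kernelForm_Lp_le hp c h h2 hδ fun i => (F i : Lp ℝ p μ)⟩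
  have h := Lp_norm_midpoint_rpow_add_le h2 h3 ((x : Lp ℝ p μ) - (u : Lp ℝ p μ))
    ((y : Lp ℝ p μ) - (u : Lp ℝ p μ))
  rw [sub_sub_sub_cancel_right] at h
  have e : midpoint ℝ x y - u = (2 : ℝ)⁻¹ • ((x - u) + (y - u)) := by
    rw [midpoint_eq_smul_add, invOf_eq_inv]
    module
  rw [e]
  exact h

/-- Repeated halving moves the point by geometrically decreasing steps; the limit is fixed by `K`,
hence by the group it generates. -/
theorem exists_fixedPoint_of_half_displacement {G E : Type*} [Group G] [TopologicalSpace G] [NormedAddCommGroup E] [NormedSpace ℝ E]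
    [CompleteSpace E] {K : Set G} (hK : IsCompact K) (hgen : Subgroup.closure K = ⊤)
    (α : G →* (E ≃ᵃⁱ[ℝ] E)) (hα : ∀ x, Continuous fun g => α g x) (C : ℝ)
    (h : ∀ (x : E) (d : ℝ), 0 < d → (∀ g ∈ K, ‖α g x - x‖ ≤ d) →
      ∃ y, ‖y - x‖ ≤ C * d ∧ ∀ g ∈ K, ‖α g y - y‖ ≤ d / 2) : ∃ x, ∀ g, α g x = x := by
  choose! f hf1 hf2 using h
  obtain ⟨D, hD⟩ := hK.exists_bound_of_continuousOn ((hα 0).sub continuous_const).continuousOn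
    (f := fun g => α g 0 - 0)
  set d := max D 1
  have hd : 0 < d := lt_max_of_lt_right one_pos
  let x : ℕ → E := fun n => Nat.rec 0 (fun k y => f y (d * (1 / 2) ^ k)) n
  have hpos : ∀ n : ℕ, 0 < d * (1 / 2) ^ n := fun n => by positivity
  have hx : ∀ n, ∀ g ∈ K, ‖α g (x n) - x n‖ ≤ d * (1 / 2) ^ n := by
    intro n
    induction n with
    | zero =>
      intro g hg
      rw [pow_zero, mul_one]
      exact (hD g hg).trans (le_max_left _ _)
    | succ n ih =>
      intro g hg
      refine (hf2 _ _ (hpos n) ih g hg).trans_eq ?_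
      rw [pow_succ]; ring
  have hcau : CauchySeq x := cauchySeq_of_le_geometric (1 / 2) (C * d) (by norm_num) fun n => by
    rw [dist_comm, dist_eq_norm]
    exact (hf1 _ _ (hpos n) (hx n)).trans_eq (by ring)
  obtain ⟨y, hy⟩ := cauchySeq_tendsto_of_complete hcau
  have hfix : ∀ g ∈ K, α g y = y := fun g hg => by
    have h1 : Filter.Tendsto (fun n => ‖α g (x n) - x n‖) Filter.atTop (𝓝 ‖α g y - y‖) :=
      ((((α g).continuous.tendsto y).comp hy).sub hy).norm
    have h2 : Filter.Tendsto (fun n : ℕ => d * (1 / 2) ^ n) Filter.atTop (𝓝 0) := by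
      simpa using (tendsto_pow_atTop_nhds_zero_of_lt_one (r := (1 / 2 : ℝ)) (by norm_num)
        (by norm_num)).const_mul d
    have h3 := le_of_tendsto_of_tendsto' h1 h2 fun n => hx n g hg
    exact sub_eq_zero.1 (norm_le_zero_iff.1 h3)
  refine ⟨y, fun g => ?_⟩
  have hg : g ∈ Subgroup.closure K := by rw [hgen]; trivial
  induction hg using Subgroup.closure_induction with
  | mem g hg => exact hfix g hg
  | one => rw [map_one]; rfl
  | mul g h _ _ h1 h2 => rw [affineAction_mul_apply, h2, h1]
  | inv g _ h1 =>
    nth_rewrite 1 [← h1]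
    rw [← affineAction_mul_apply, inv_mul_cancel, map_one]; rfl

variable {G : Type u} [Group G] [TopologicalSpace G] [IsTopologicalGroup G]
  [LocallyCompactSpace G] [SecondCountableTopology G]

open Filter in
/-- Under property (T), displacement on a compact generating set can be halved at linear cost, for
all affine isometric actions on spaces close to Hilbert spaces. -/
theorem HasPropertyT.exists_half_displacement (hT : HasPropertyT.{u, v} G) {K : Set G}
    (hK : IsCompact K) (hK1 : K ∈ 𝓝 1) (hgen : Subgroup.closure K = ⊤) :
    ∃ ε : ℝ, 0 < ε ∧ ∃ C : ℝ, ∀ (E : Type v) [NormedAddCommGroup E] [NormedSpace ℝ E] (r : ℝ),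
      IsNearHilbert E r → r < 2 + ε → ∀ α : G →* (E ≃ᵃⁱ[ℝ] E), (∀ x, Continuous fun g => α g x) →
        ∀ (x : E) (d : ℝ), 0 < d → (∀ g ∈ K, ‖α g x - x‖ ≤ d) →
          ∃ y, ‖y - x‖ ≤ C * d ∧ ∀ g ∈ K, ‖α g y - y‖ ≤ d / 2 := by
  by_contra! hcon
  -- The negation is used with `ε = 1 / (n + 1)` and `C = n + 1`: exponents tend to `2`, and no
  -- point within `(n + 1) * d n` of `x n` has its displacement halved.
  choose E i1 i2 r hE hr α hα x d hd hx hfar using fun n : ℕ =>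
    hcon (1 / ((n : ℝ) + 1)) Nat.one_div_pos_of_nat (n + 1)
  obtain ⟨N, hN, hsm⟩ := exists_smoothing.{u, v} hK hK1
  have hy := fun n => by
    have := (hE n).complete
    exact hsm (E n) (α n) (hα n) (x n) (d n) (hx n)
  choose y hyx hyN using hy
  have hiso : ∀ n g (a b : E n), ‖α n g a - α n g b‖ = ‖a - b‖ := fun n g a b => by
    rw [← dist_eq_norm, (α n g).dist_map, dist_eq_norm]
  -- On `K` the constant is `3`, as `y n` lies within `d n` of `x n`; it extends to all of `G` by
  -- word length.
  have hbd : ∀ g, ∃ C : ℝ, ∀ n, ‖α n g (y n) - y n‖ ≤ C * d n := by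
    intro g
    have hg : g ∈ Subgroup.closure K := by rw [hgen]; trivial
    induction hg using Subgroup.closure_induction with
    | mem g hg =>
      refine ⟨3, fun n => ?_⟩
      have h1 : α n g (y n) - y n = (α n g (y n) - α n g (x n)) + (α n g (x n) - x n) -
        (y n - x n) := by abel
      rw [h1]
      refine (norm_sub_le _ _).trans ?_
      have h2 := norm_add_le (α n g (y n) - α n g (x n)) (α n g (x n) - x n)
      rw [hiso] at h2
      linarith [hyx n, hx n g hg]
    | one => exact ⟨0, fun n => by rw [map_one]; simp⟩
    | mul g h _ _ h1 h2 =>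
      obtain ⟨C, hC⟩ := h1
      obtain ⟨C', hC'⟩ := h2
      refine ⟨C + C', fun n => ?_⟩
      have h3 : α n (g * h) (y n) - y n = (α n g (α n h (y n)) - α n g (y n)) +
        (α n g (y n) - y n) := by rw [affineAction_mul_apply]; abel
      rw [h3]
      refine (norm_add_le _ _).trans ?_
      rw [hiso]
      linarith [hC n, hC' n]
    | inv g _ h1 =>
      obtain ⟨C, hC⟩ := h1
      refine ⟨C, fun n => ?_⟩
      rw [← hiso n g, ← affineAction_mul_apply, mul_inv_cancel, map_one, norm_sub_rev]
      exact hC n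
  have hc : ∀ ε : ℝ, 0 < ε → ∀ᶠ h in 𝓝 (1 : G), ∀ n, ‖α n h (y n) - y n‖ ≤ ε * d n := by
    intro ε hε
    filter_upwards [hN.eventually (gt_mem_nhds hε), hK1] with h h1 h2 n
    refine (hyN n h h2).trans ?_
    rw [mul_comm]
    exact mul_le_mul_of_nonneg_right h1.le (hd n).le
  have hcn : ∀ (S : Type v) (c : S →₀ ℝ), ∑ i ∈ c.support, c i = 0 → ∀ η : ℝ, 0 < η →
      ∀ᶠ n in atTop, ∀ F : S → E n, kernelForm (fun i j => ‖F i - F j‖ ^ r n) c ≤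
        η * ∑ i ∈ c.support, ‖F i‖ ^ r n := by
    intro S c hcs η hη
    obtain ⟨δ, hδ, h⟩ := kernelForm_abs_sub_rpow_le c hcs hη
    filter_upwards [(tendsto_one_div_add_atTop_nhds_zero_nat (𝕜 := ℝ)).eventually
      (gt_mem_nhds hδ)] with n hn F
    exact (hE n).kernelForm_le S c η δ h (by linarith [hr n]) F
  obtain ⟨R, hR⟩ := hT.exists_small_displacement_of_limit hK E r (fun n => (hE n).two_le)
    (fun n => (hE n).le_three) hcn (fun n => (hE n).clarkson) α y d hd hbd hc
  -- `R` does not depend on `n`, so for some `n ≥ R` the point found lies within `(R + 1) * d n ≤ (n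
  -- + 1) * d n` of `x n`.
  obtain ⟨m, hm⟩ := exists_nat_ge R
  obtain ⟨n, ⟨z, hz1, hz2⟩, hn⟩ := (hR.and_eventually (eventually_ge_atTop m)).exists
  have hRn : R ≤ n := hm.trans (by exact_mod_cast hn)
  obtain ⟨g, hg, hlt⟩ := hfar n z (by
    have h1 : z - x n = (z - y n) + (y n - x n) := by abel
    rw [h1]
    refine (norm_add_le _ _).trans ?_
    have := mul_le_mul_of_nonneg_right hRn (hd n).le
    linarith [hyx n])
  exact absurd (hz2 g hg) (not_le.2 hlt)

theorem HasPropertyT.hasPropertyFB_near_two (hT : HasPropertyT.{u, v} G) :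
    ∃ ε : ℝ, 0 < ε ∧ ∀ (X : Type v) [MeasurableSpace X] (μ : Measure X) (p : ℝ≥0∞) [Fact (1 ≤ p)],
      2 ≤ p → p < 2 + ENNReal.ofReal ε → ∀ B : Submodule ℝ (Lp ℝ p μ),
        IsClosed (B : Set (Lp ℝ p μ)) → HasPropertyFB G B := by
  obtain ⟨K, hK, hK1, hgen⟩ := hT.exists_compact_generating
  obtain ⟨ε, hε, C, h⟩ := hT.exists_half_displacement hK hK1 hgen
  -- The bound `1` keeps `p ≤ 3`, the range of the weak Clarkson inequality.
  refine ⟨min ε 1, lt_min hε one_pos, fun X _ μ p _ h2 hpε B hB α hα => ?_⟩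
  have h3 : p ≤ 3 := by
    refine hpε.le.trans ?_
    calc 2 + ENNReal.ofReal (min ε 1) ≤ 2 + ENNReal.ofReal 1 := by
          gcongr; exact min_le_right _ _
      _ = 3 := by rw [ENNReal.ofReal_one]; norm_num
  have hp : p ≠ ∞ := ne_top_of_le_ne_top ENNReal.ofNat_ne_top h3
  have hr : p.toReal < 2 + ε := by
    have h4 := (ENNReal.toReal_lt_toReal hp (by simp)).2 hpε
    rw [ENNReal.toReal_add (by simp) (by simp), ENNReal.toReal_ofReal (lt_min hε one_pos).le] at h4
    have := min_le_left ε 1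
    simp at h4
    linarith
  have hE := isNearHilbert_Lp h2 h3 B hB
  have := hE.complete
  have hα' : ∀ x, Continuous fun g => α g x := fun x =>
    hα.comp (continuous_id.prodMk continuous_const)
  exact exists_fixedPoint_of_half_displacement hK hgen α hα' C (h B p.toReal hE hr α hα')

end NearHilbert

theorem theoremT (G : Type u) [Group G] [TopologicalSpace G] [IsTopologicalGroup G]
    [LocallyCompactSpace G] [SecondCountableTopology G] :
    -- (1) `(F_B)` implies `(T_B)` for every Banach space `B`
    (∀ (B : Type w) [NormedAddCommGroup B] [NormedSpace ℝ B] [CompleteSpace B],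
      HasPropertyFB G B → HasPropertyTB G B) ∧
    -- (2) (T) implies `(F_B)` for closed subspaces of `L^p(μ)`, `1 < p ≤ 2`
    (HasPropertyT.{u, v} G →
      ∀ (X : Type v) [MeasurableSpace X] [StandardBorelSpace X] (μ : Measure X) [SigmaFinite μ]
        (p : ℝ≥0∞) [Fact (1 ≤ p)], 1 < p → p ≤ 2 →
        ∀ B : Submodule ℝ (Lp ℝ p μ), IsClosed (B : Set (Lp ℝ p μ)) → HasPropertyFB G B) ∧
    -- (2) (T) implies boundedness of orbits on subspaces of `L^p(μ)`, `0 < p ≤ 1`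
    (HasPropertyT.{u, v} G →
      ∀ (X : Type v) [MeasurableSpace X] [StandardBorelSpace X] (μ : Measure X) [SigmaFinite μ]
        (p : ℝ≥0∞), 0 < p → p ≤ 1 →
        ∀ B : Submodule ℝ (Lp ℝ p μ), HasBoundedLpOrbits G B) ∧
    -- (3) (T) implies `(F_B)` for closed subspaces of `L^p(μ)`, `2 ≤ p < 2 + ε(G)`
    (HasPropertyT.{u, v} G →
      ∃ ε : ℝ, 0 < ε ∧
        ∀ (X : Type v) [MeasurableSpace X] [StandardBorelSpace X] (μ : Measure X) [SigmaFinite μ]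
          (p : ℝ≥0∞) [Fact (1 ≤ p)], 2 ≤ p → p < 2 + ENNReal.ofReal ε →
          ∀ B : Submodule ℝ (Lp ℝ p μ), IsClosed (B : Set (Lp ℝ p μ)) → HasPropertyFB G B) := by
  exact ⟨fun _ _ _ _ hF => hF.hasPropertyTB,
    fun hT _ _ _ _ _ _ _ hp1 hp2 B hB => hT.hasPropertyFB_of_le_two hp1 hp2 B hB,
    fun hT _ _ _ _ _ _ hp0 hp1 B =>
      hT.hasBoundedLpOrbits hp0.ne' (hp1.trans (by norm_num)) B,
    fun hT => by
      obtain ⟨ε, hε, h⟩ := hT.hasPropertyFB_near_two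
      exact ⟨ε, hε, fun X _ _ μ _ p _ h2 hp B hB => h X μ p h2 hp B hB⟩⟩
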